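/- Let $d,n,r\ge 0$ and $k_1,\dots,k_r\ge 0$ be integers with $n+\sum_{i=1}^r k_i=3d-1$. A rational tropical curve of degree $d$ with $n+r$ marked points is a map $h:\Gamma\to\mathbb R^2$, affine with integer slope on edges and balanced at each vertex, where $\Gamma$ is a metric tree without bivalent vertices whose labelled ends are $n+r$ contracted ends (the marked points) and $d$ ends of each of the slopes $(0,-1),(-1,0),(1,1)$. For a vertex $V$ let $I_V$ be the set of marked points adjacent to it. Put $k_m=0$ for the first $n$ marked points (the $P$-markings) and let $k_i$ be attached to the $i$-th of the last $r$ (the $\psi^{k_i}L$-markings). The subfan $\psi_1^{k_1}\cdots\psi_r^{k_r}$ of the moduli space $\mathcal M_{0,n+r}(\mathbb R^2,d)$ is the union of the closed cones of the combinatorial types with $\mathrm{val}(V)=3+\sum_{m\in I_V}k_m$ for all $V$ (ends included in the valency), each with weight $\prod_V(\sum_{m\in I_V}k_m)!/\prod_m k_m!$. Let $P_1,\dots,P_n\in\mathbb R^2$ be points and $L_1,\dots,L_r\subset\mathbb R^2$ standard tropical lines (rays in directions $(0,-1),(-1,0),(1,1)$ from an apex). Assume that they are generic: the tuple of the points and the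 apices, in $(\mathbb R^2)^{n+r}$, lies outside a certain finite union of proper affine subspaces depending only on $d,n,r$ and the $k_i$. Let $h:\Gamma\to\mathbb R^2$ be a solution, i.e. an element of the subfan whose $j$-th $P$-marking is mapped to $P_j$ and whose $i$-th $\psi^{k_i}L$-marking is mapped into $L_i$, and assume that the $\psi^{k_i}L$-markings are adjacent to pairwise distinct vertices $V_1,\dots,V_r$. Then the solution lies in the interior of a top-dimensional cone of the subfan, and each $h(V_i)$ lies in the interior of a unique ray of $L_i$; let $u_i$ be the direction of this ray. The multiplicity $m_\Gamma$ of the solution is the intersection index of the evaluation map at the marked points with $\prod_j\{P_j\}\times\prod_i L_i$ at $(\Gamma,h)$, that is, the weight of the cone times the index in $(\mathbb Z^2)^{n+r}$ of the sum of the image under evaluation of the lattice of the cone (integral position of a vertex and integral lengths of the bounded edges) and of the lattice spanned by the vectors $u_i$ placed in the $i$-th line factor. Let $\mathcal B(\Gamma)$ be the bipartite graph whose white vertices are the bounded components (those containing no end) of the complement in $\Gamma$ of the marked points (each removed together with its adjacent vertex), whose black vertices are the $r$ $\psi^{k_i}L$-markings, and in which a marking is joined to the bounded components it is adjacent to. Then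 $\mathcal B(\Gamma)$ has a unique orientation for which each white vertex has exactly one outward edge and each black vertex has exactly one inward edge. If $v_i$ denotes the slope of $h$ on the edge of $\Gamma$ adjacent to $V_i$ which belongs to the bounded component from which the unique inward edge at the $i$-th black vertex comes, then $$m_\Gamma=\prod_{i=1}^r|\det(u_i,v_i)|\ \prod_V m_V,$$ where $V$ runs over the (trivalent) vertices not adjacent to any marked point and $m_V=|\det(a_V,b_V)|$ for the outgoing slopes $a_V,b_V$ along any two edges adjacent to $V$. -/

import Mathlib

open scoped BigOperators

noncomputable section

namespace TropicalCount

/-- An abstract rational tropical curve whose ends are labelled by `ι`. The vertices of valency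
greater than one form the set `V`; they are joined by the bounded edges, which form a finite tree
`graph`, and the end labelled `l` is an unbounded ray attached at `endVertex l`. The vertex at
infinity of each end is omitted. -/
structure AbstractCurve (ι V : Type) where
  /-- the graph formed by the bounded edges -/
  graph : SimpleGraph V
  isTree : graph.IsTree
  /-- the vertex to which an end is attached -/
  endVertex : ι → V
  /-- the length of a bounded edge -/
  length : graph.edgeSet → ℝ
  length_pos : ∀ e, 0 < length e

namespace AbstractCurve

variable {ι V : Type}

/-- The edges adjacent to `v`: bounded edges oriented outside `v`, and ends attached to `v`. -/
abbrev Flag (Γ : AbstractCurve ι V) (v : V) : Type :=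
  {a : Γ.graph.Dart // a.fst = v} ⊕ {l : ι // Γ.endVertex l = v}

instance finite_dart [Finite V] (Γ : AbstractCurve ι V) : Finite Γ.graph.Dart :=
  Finite.of_injective (fun a => a.toProd) (fun _ _ hab => SimpleGraph.Dart.ext _ _ hab)

instance fintype_flag [Finite V] [Finite ι] (Γ : AbstractCurve ι V) (v : V) :
    Fintype (Γ.Flag v) :=
  Fintype.ofFinite _

/-- The valency of a vertex, all ends included. -/
def valency [Finite V] [Finite ι] (Γ : AbstractCurve ι V) (v : V) : ℕ :=
  Fintype.card (Γ.Flag v)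

/-- The bounded edge underlying an oriented bounded edge. -/
def dartEdge (Γ : AbstractCurve ι V) (a : Γ.graph.Dart) : Γ.graph.edgeSet :=
  ⟨a.edge, a.edge_mem⟩

end AbstractCurve

/-- Marked points: `n` markings subject to a point constraint, and `r` markings subject to a
line constraint. -/
abbrev Mark (n r : ℕ) : Type := Fin n ⊕ Fin r

/-- Labels of the ends of a curve of degree `d`: the marked points, and `d` ends in each of the
three standard directions. -/
abbrev Label (n r d : ℕ) : Type := Mark n r ⊕ (Fin 3 × Fin d)

/-- The directions of the rays of the standard tropical line. -/
def dir : Fin 3 → ℤ × ℤ := ![(0, -1), (-1, 0), (1, 1)]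

/-- The slope of an end: zero for the marked points, a standard direction for the other ends. -/
def endSlope {n r d : ℕ} : Label n r d → ℤ × ℤ :=
  Sum.elim (fun _ => 0) (fun p => dir p.1)

/-- The inclusion of the lattice `ℤ²` in `ℝ²`. -/
def toReal (a : ℤ × ℤ) : ℝ × ℝ := ((a.1 : ℝ), (a.2 : ℝ))

/-- The determinant of two vectors of `ℤ²`. -/
def det (a b : ℤ × ℤ) : ℤ := a.1 * b.2 - a.2 * b.1

/-- The outgoing slope along an edge adjacent to `v`, for given slopes of the bounded edges. -/
def AbstractCurve.flagSlope {n r d : ℕ} {V : Type} (Γ : AbstractCurve (Label n r d) V)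
    (slope : Γ.graph.Dart → ℤ × ℤ) (v : V) : Γ.Flag v → ℤ × ℤ :=
  Sum.elim (fun a => slope a.1) (fun l => endSlope l.1)

/-- The balancing condition: at each vertex the outgoing slopes add up to zero. -/
def AbstractCurve.IsBalanced {n r d : ℕ} {V : Type} [Finite V]
    (Γ : AbstractCurve (Label n r d) V) (slope : Γ.graph.Dart → ℤ × ℤ) : Prop :=
  ∀ v, ∑ f : Γ.Flag v, Γ.flagSlope slope v f = 0

/-- A parametrized rational tropical curve `h : Γ → ℝ²` of degree `d` with `n + r` marked points.
The map is given by the images `pos` of the vertices and the slopes of the oriented bounded edges;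
on an end it is the ray with the slope prescribed by the label. -/
structure ParamCurve (n r d : ℕ) (V : Type) [Finite V] extends
    AbstractCurve (Label n r d) V where
  /-- there are no bivalent vertices -/
  stable : ∀ v, 3 ≤ toAbstractCurve.valency v
  /-- the image of a vertex -/
  pos : V → ℝ × ℝ
  /-- the slope along an oriented bounded edge -/
  slope : graph.Dart → ℤ × ℤ
  affine : ∀ a : graph.Dart,
    pos a.snd - pos a.fst = length (toAbstractCurve.dartEdge a) • toReal (slope a)
  balanced : toAbstractCurve.IsBalanced slope

/-- The open ray of the tropical line with apex `p` in the standard direction `s`. -/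
def openRay (p : ℝ × ℝ) (s : Fin 3) : Set (ℝ × ℝ) :=
  {x | ∃ t : ℝ, 0 < t ∧ x = p + t • toReal (dir s)}

/-- The standard tropical line with apex `p`. -/
def tropicalLine (p : ℝ × ℝ) : Set (ℝ × ℝ) :=
  {x | ∃ s : Fin 3, ∃ t : ℝ, 0 ≤ t ∧ x = p + t • toReal (dir s)}

/-- The integral tangent vectors of the tropical line with apex `p` at a point `x` that lies in
the interior of one of its rays. -/
def lineLattice (p x : ℝ × ℝ) : AddSubgroup (ℤ × ℤ) :=
  AddSubgroup.closure {a | ∃ s, x ∈ openRay p s ∧ a = dir s}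

/-- The exponents of the psi-classes: zero at the point constraints, `k i` at the `i`-th line
constraint. -/
def psiExponent {n r : ℕ} (k : Fin r → ℕ) : Mark n r → ℕ := Sum.elim (fun _ => 0) k

namespace ParamCurve

variable {n r d : ℕ} {V : Type} [Finite V]

/-- The vertex adjacent to a marked point. -/
def markVertex (h : ParamCurve n r d V) (m : Mark n r) : V := h.endVertex (Sum.inl m)

open Classical in
/-- The set `I_v` of marked points adjacent to the vertex `v`. -/
def marksAt (h : ParamCurve n r d V) (v : V) : Finset (Mark n r) :=
  Finset.univ.filter fun m => h.markVertex m = v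

/-- `(Γ, h)` lies in the interior of a top-dimensional cone of the subfan
`ψ_1^{k_1} ⋯ ψ_r^{k_r}` of the moduli space. -/
def InOpenTopCone (h : ParamCurve n r d V) (k : Fin r → ℕ) : Prop :=
  ∀ v, h.valency v = 3 + ∑ m ∈ h.marksAt v, psiExponent k m

/-- `(Γ, h)` belongs to the subfan `ψ_1^{k_1} ⋯ ψ_r^{k_r}`. The combinatorial types with this
property are exactly those obtained from the types of the top-dimensional cones by contracting
bounded edges, i.e. the faces of these cones. -/
def InPsiFan (h : ParamCurve n r d V) (k : Fin r → ℕ) : Prop :=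
  ∀ v, 3 + ∑ m ∈ h.marksAt v, psiExponent k m ≤ h.valency v

/-- `(Γ, h)` is a solution to the enumerative problem with constraints `ξ`: the marked points with
a point constraint are mapped to the points `ξ (inl j)`, those with a line constraint are mapped
to the tropical lines with apices `ξ (inr i)`. -/
structure IsSolution (h : ParamCurve n r d V) (k : Fin r → ℕ) (ξ : Mark n r → ℝ × ℝ) : Prop where
  psi : h.InPsiFan k
  point : ∀ j, h.pos (h.markVertex (Sum.inl j)) = ξ (Sum.inl j)
  line : ∀ i, h.pos (h.markVertex (Sum.inr i)) ∈ tropicalLine (ξ (Sum.inr i))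

/-! ### The multiplicity -/

/-- The lattice of the cone of the moduli space containing `(Γ, h)`: integral variations of
the positions of the vertices and of the lengths of the bounded edges, for fixed slopes. It is
isomorphic to `ℤ² × ℤ^E` by means of the position of a root vertex and the `E` lengths. -/
def coneLattice (h : ParamCurve n r d V) :
    AddSubgroup ((V → ℤ × ℤ) × (h.graph.edgeSet → ℤ)) where
  carrier := {x | ∀ a : h.graph.Dart,
    x.1 a.snd - x.1 a.fst = x.2 (h.dartEdge a) • h.slope a}
  zero_mem' := by intro a; simp
  add_mem' := by
    intro x y hx hy a
    have h1 := hx a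
    have h2 := hy a
    simp only [Prod.fst_add, Prod.snd_add, Pi.add_apply, add_smul]
    rw [← h1, ← h2]
    abel
  neg_mem' := by
    intro x hx a
    have h1 := hx a
    simp only [Prod.fst_neg, Prod.snd_neg, Pi.neg_apply, neg_smul]
    rw [← h1]
    abel

/-- The linear part of the evaluation map at the marked points. -/
def evalHom (h : ParamCurve n r d V) :
    (V → ℤ × ℤ) × (h.graph.edgeSet → ℤ) →+ (Mark n r → ℤ × ℤ) where
  toFun x m := x.1 (h.markVertex m)
  map_zero' := rfl
  map_add' _ _ := rfl

/-- The lattice of integral tangent vectors of the cycle `Ξ` of constraints at the image of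
`(Γ, h)`. -/
def constraintLattice (h : ParamCurve n r d V) (ξ : Mark n r → ℝ × ℝ) :
    AddSubgroup (Mark n r → ℤ × ℤ) :=
  AddSubgroup.pi Set.univ fun m => Sum.elim (fun _ => ⊥)
    (fun i => lineLattice (ξ (Sum.inr i)) (h.pos (h.markVertex (Sum.inr i)))) m

/-- The multiplicity of a solution, i.e. the intersection index of the evaluation map and the
cycle of constraints at `(Γ, h)`: the weight `∏_v (∑_{i ∈ I_v} k_i)! / ∏_i k_i!` of the cone,
times the index in `(ℤ²)^{n+r}` of the sum of the image of the lattice of the cone and of the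
tangent lattice of the constraints. (The index, i.e. the absolute value of the determinant of the
evaluation map modulo the directions of the constraints, is zero if it is not finite.) -/
def multiplicity [Fintype V] (h : ParamCurve n r d V) (k : Fin r → ℕ)
    (ξ : Mark n r → ℝ × ℝ) : ℕ :=
  (∏ v, Nat.multinomial (h.marksAt v) (psiExponent k)) *
    (h.coneLattice.map h.evalHom ⊔ h.constraintLattice ξ).index

/-! ### Complement of the marked points and the bipartite graph -/

/-- The edges of `Γ` other than the contracted ends: bounded edges and ends of nonzero slope. -/
abbrev Edge (h : ParamCurve n r d V) : Type := h.graph.edgeSet ⊕ (Fin 3 × Fin d)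

/-- The vertex `v` is adjacent to the edge `e`. -/
def Incident (h : ParamCurve n r d V) (v : V) : h.Edge → Prop :=
  Sum.elim (fun e => v ∈ e.1) (fun j => h.endVertex (Sum.inr j) = v)

/-- Two distinct edges are joined if they share a vertex that is not adjacent to a marked point. -/
def complementGraph (h : ParamCurve n r d V) : SimpleGraph h.Edge where
  Adj e e' := e ≠ e' ∧ ∃ v, h.marksAt v = ∅ ∧ h.Incident v e ∧ h.Incident v e'
  symm := ⟨fun _ _ ⟨hne, v, h0, h1, h2⟩ => ⟨hne.symm, v, h0, h2, h1⟩⟩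
  loopless := ⟨fun _ he => he.1 rfl⟩

/-- The connected components of the complement in `Γ` of the marked points (a marked point being
removed together with the vertex it is adjacent to), each of them given by its edges. -/
abbrev Component (h : ParamCurve n r d V) : Type := h.complementGraph.ConnectedComponent

/-- The component containing an edge. -/
def component (h : ParamCurve n r d V) (e : h.Edge) : h.Component :=
  h.complementGraph.connectedComponentMk e

/-- The bounded components: those that contain no end. -/
abbrev BoundedComponent (h : ParamCurve n r d V) : Type :=
  {c : h.Component // ∀ j, h.component (Sum.inr j) ≠ c}

/-- The marking with the `i`-th line constraint is adjacent to the component `c`. -/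
def Touches (h : ParamCurve n r d V) (i : Fin r) (c : h.BoundedComponent) : Prop :=
  ∃ e, h.Incident (h.markVertex (Sum.inr i)) e ∧ h.component e = c.1

/-- The bipartite graph `B(Γ)`: its white vertices are the bounded components of the complement of
the marked points, its black vertices are the markings with a line constraint. -/
def bipartiteGraph (h : ParamCurve n r d V) : SimpleGraph (h.BoundedComponent ⊕ Fin r) where
  Adj x y := ∃ c i, h.Touches i c ∧
    (x = Sum.inl c ∧ y = Sum.inr i ∨ x = Sum.inr i ∧ y = Sum.inl c)
  symm := ⟨fun _ _ ⟨c, i, hci, hxy⟩ =>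
    ⟨c, i, hci, hxy.elim (fun p => Or.inr ⟨p.2, p.1⟩) (fun p => Or.inl ⟨p.2, p.1⟩)⟩⟩
  loopless := ⟨by
    rintro x ⟨c, i, -, ⟨h1, h2⟩ | ⟨h1, h2⟩⟩ <;> simp [h1] at h2⟩

/-- `o` is an orientation of `B(Γ)` (`o x y` meaning that `x` and `y` are joined by an edge oriented
from `x` to `y`) for which each white vertex has exactly one outward edge and each black vertex
has exactly one inward edge. -/
structure IsAdmissibleOrientation (h : ParamCurve n r d V)
    (o : h.BoundedComponent ⊕ Fin r → h.BoundedComponent ⊕ Fin r → Prop) : Prop where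
  adj_iff : ∀ x y, h.bipartiteGraph.Adj x y ↔ o x y ∨ o y x
  asymm : ∀ x y, o x y → ¬ o y x
  white : ∀ c : h.BoundedComponent, ∃! y, o (Sum.inl c) y
  black : ∀ i : Fin r, ∃! x, o x (Sum.inr i)

open Classical in
/-- The vertices that are not adjacent to a marked point. -/
def unmarked [Fintype V] (h : ParamCurve n r d V) : Finset V :=
  Finset.univ.filter fun v => h.marksAt v = ∅

end ParamCurve

end TropicalCount

end

/-!
The multiplicity is computed from an orientation of the bounded edges of `Γ`, which is obtained from
transversality by linear algebra; the bipartite graph `B(Γ)` is only a shadow of this orientation.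

*Genericity.* The constraints `ξ` are a combination of integral vectors of the following kinds: the
two translations, for each bounded edge its slope on the marked points beyond it, and for each line
constraint the direction of a ray (`ParamCurve.sum_tangent`). Since the slope of an edge is the sum
of the slopes of the ends beyond it, these vectors belong to a finite set depending only on `n`, `r`
and `d`, so that for generic `ξ` they span the whole space. There are `|V| + 1 + r` of them, and
`|V| + 1 ≤ 2n + r` by the valency conditions. Hence equality holds, the curve lies in a cone of
maximal dimension, no marking is mapped to an apex, and the vectors are linearly independent
(`ParamCurve.exists_linearIndependent_tangent`).

*The orientation.* By linear independence the `2|V|` scalar equations on the positions `x` of the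
vertices (`det (slope, x_w - x_v) = 0` for an edge, `det (u_i, x) = 0` at a line constraint, two
equations at a point constraint) have only the zero solution. A nonzero term of the Leibniz
expansion of their determinant gives each vertex two of the equations in which it is involved. This
orients the bounded edges, each towards the vertex to which its equation is given
(`ParamCurve.Flow`): two edges come in at a vertex without marked points, one at `V_i`, none at a
point constraint. On a tree the orientation is acyclic, in fact the number of oriented edges having
a vertex in front of them is a height function (`ParamCurve.Flow.height_lt`).

*The index.* Ordered by height, the equations form a triangular system with a `2 × 2` block for each
vertex. Adding the vertices one at a time shows that the index of the lattice in question is the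
product of the determinants of the blocks (`index_triangular`,
`ParamCurve.Flow.index_eq_prod`). These are the multiplicities `m_V` of the vertices without marked
points, `det (u_i, v_i)` with `v_i` the slope of the incoming edge at `V_i`, and `1` at the point
constraints.

*The bipartite graph.* Inside a component of the complement of the marked points each vertex has
exactly one outgoing edge, so all edges of the component lead to the same last edge, which is an end
or the incoming edge at one of the `V_i`. Therefore bounded components correspond to line
constraints, which gives an admissible orientation of `B(Γ)`. Every line constraint that touches
the component leading to `V_i` is at height at most that of `V_i`, with equality only for the
`i`-th one; comparing sums of heights, any other admissible orientation is excluded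
(`ParamCurve.Flow.orientation_unique`).
-/

noncomputable section

namespace TropicalCount

/-! ### Edges of a tree and the sides they separate -/

section Sides

variable {V : Type} {G : SimpleGraph V}

/-- The vertices of the graph beyond the oriented edge `a`: those that are reachable from its
endpoint without passing through the edge. -/
def side (a : G.Dart) : Set V := {v | (G.deleteEdges {a.edge}).Reachable a.snd v}

theorem snd_mem_side (a : G.Dart) : a.snd ∈ side a := SimpleGraph.Reachable.refl _

theorem fst_notMem_side (hG : G.IsTree) (a : G.Dart) : a.fst ∉ side a := by
  intro h
  have hb := (SimpleGraph.isAcyclic_iff_forall_adj_isBridge.1 hG.isAcyclic) a.adj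
  rw [SimpleGraph.isBridge_iff] at hb
  exact hb (SimpleGraph.Reachable.symm h)

/-- An oriented edge is the only edge through which its side can be entered or left. -/
theorem mem_side_iff_of_ne {a b : G.Dart} (h1 : b ≠ a) (h2 : b ≠ a.symm) :
    b.fst ∈ side a ↔ b.snd ∈ side a := by
  have hadj : (G.deleteEdges {a.edge}).Adj b.fst b.snd := by
    rw [SimpleGraph.deleteEdges_adj]
    refine ⟨b.adj, fun h => ?_⟩
    have h' : b.edge = a.edge := h
    rcases (SimpleGraph.dart_edge_eq_iff b a).1 h' with h | h
    · exact h1 h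
    · exact h2 h
  exact ⟨fun h => SimpleGraph.Reachable.trans h hadj.reachable,
    fun h => SimpleGraph.Reachable.trans h hadj.symm.reachable⟩

theorem mem_side_symm_iff (hG : G.IsTree) (a : G.Dart) (v : V) :
    v ∈ side a.symm ↔ v ∉ side a := by
  constructor
  · intro h h'
    have h1 : (G.deleteEdges {a.edge}).Reachable a.fst v := by
      have : v ∈ side a.symm := h
      simpa [side] using this
    exact fst_notMem_side hG a (SimpleGraph.Reachable.trans h' h1.symm)
  · intro h
    by_contra h'
    -- the union of the two sides is closed under adjacency
    have key : ∀ u w, G.Adj u w → u ∈ side a ∪ side a.symm → w ∈ side a ∪ side a.symm := by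
      intro u w huw hu
      let b : G.Dart := ⟨(u, w), huw⟩
      by_cases h1 : b = a
      · left
        have : w = a.snd := by rw [← h1]
        rw [this]; exact snd_mem_side a
      by_cases h2 : b = a.symm
      · right
        have : w = a.symm.snd := by rw [← h2]
        rw [this]; exact snd_mem_side _
      rcases hu with hu | hu
      · exact Or.inl ((mem_side_iff_of_ne h1 h2).1 hu)
      · refine Or.inr ((mem_side_iff_of_ne (a := a.symm) h2 ?_).1 hu)
        rwa [SimpleGraph.Dart.symm_symm]
    have hreach : ∀ w, G.Reachable a.snd w → w ∈ side a ∪ side a.symm := by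
      rintro w ⟨p⟩
      have : ∀ (u w : V) (p : G.Walk u w), u ∈ side a ∪ side a.symm →
          w ∈ side a ∪ side a.symm := by
        intro u w p
        induction p with
        | nil => exact id
        | cons hadj _ ih => exact fun hu => ih (key _ _ hadj hu)
      exact this _ _ p (Or.inl (snd_mem_side a))
    rcases hreach v (hG.connected.preconnected _ _) with h1 | h1
    · exact h h1
    · exact h' h1

variable [Fintype G.Dart] {M : Type*} [AddCommGroup M]

open Classical in
/-- The sum of `y` over the oriented edges of the path from `ρ` to `v`. -/
def potential (ρ : V) (y : G.Dart → M) (v : V) : M :=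
  ∑ a, if ρ ∉ side a ∧ v ∈ side a then y a else 0

theorem potential_snd_sub_fst (hG : G.IsTree) (ρ : V) (y : G.Dart → M)
    (hy : ∀ a, y a.symm = - y a) (b : G.Dart) :
    potential ρ y b.snd - potential ρ y b.fst = y b := by
  classical
  unfold potential
  rw [← Finset.sum_sub_distrib]
  -- only the edge `b`, oriented away from `ρ`, separates its own endpoints
  by_cases hρ : ρ ∈ side b
  · rw [Finset.sum_eq_single b.symm]
    · have h1 : ρ ∉ side b.symm := by rw [mem_side_symm_iff hG]; exact fun h => h hρ
      have h2 : b.fst ∈ side b.symm := snd_mem_side b.symm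
      have h3 : b.snd ∉ side b.symm := fst_notMem_side hG b.symm
      simp [h1, h2, h3, hy]
    · intro a _ ha
      by_cases hab : a = b
      · subst hab; simp [hρ]
      · have : b ≠ a.symm := by rintro rfl; simp at ha
        rw [mem_side_iff_of_ne (Ne.symm hab) this, sub_self]
    · simp
  · rw [Finset.sum_eq_single b]
    · simp [hρ, snd_mem_side, fst_notMem_side hG]
    · intro a _ ha
      by_cases hab : a = b.symm
      · subst hab
        have : ρ ∈ side b.symm := (mem_side_symm_iff hG _ _).2 hρ
        simp [this]
      · have : b ≠ a.symm := by rintro rfl; simp at hab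
        rw [mem_side_iff_of_ne (Ne.symm ha) this, sub_self]
    · simp

theorem potential_self (ρ : V) (y : G.Dart → M) : potential ρ y ρ = 0 := by
  classical
  unfold potential
  exact Finset.sum_eq_zero fun a _ => if_neg fun h => h.1 h.2

/-- A function on the vertices of a tree is determined by its value at one vertex and its
increments along the edges. -/
theorem eq_add_potential (hG : G.IsTree) (ρ : V) (x : V → M) (y : G.Dart → M)
    (h : ∀ a : G.Dart, x a.snd - x a.fst = y a) (v : V) :
    x v = x ρ + potential ρ y v := by
  have hy : ∀ a, y a.symm = - y a := by
    intro a
    rw [← h, ← h]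
    simp
  have hconst : ∀ (u w : V) (p : G.Walk u w),
      x w - potential ρ y w = x u - potential ρ y u := by
    intro u w p
    induction p with
    | nil => rfl
    | @cons u w' w hadj _ ih =>
      rw [ih]
      have h1 := h ⟨(u, w'), hadj⟩
      have h2 := potential_snd_sub_fst hG ρ y hy ⟨(u, w'), hadj⟩
      simp only at h1 h2
      rw [sub_eq_sub_iff_sub_eq_sub, h1, h2]
  obtain ⟨p⟩ := hG.connected.preconnected ρ v
  have := hconst _ _ p
  rw [potential_self, sub_zero] at this
  rw [← this]; abel

/-- Summing an antisymmetric function over the oriented edges that start in a side of a tree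
leaves only the edge through which the side is left. -/
theorem two_nsmul_sum_side (hG : G.IsTree) (y : G.Dart → M) (hy : ∀ a, y a.symm = - y a)
    (a : G.Dart) [DecidablePred (· ∈ side a)] :
    (2 : ℕ) • (∑ b, if b.fst ∈ side a then y b else 0) = - ((2 : ℕ) • y a) := by
  classical
  -- reversing all edges in one of the two sums makes the edges that stay on one side cancel
  have h1 : (∑ b, if b.fst ∈ side a then y b else 0)
      = ∑ b : G.Dart, if b.snd ∈ side a then - y b else 0 := by
    refine Fintype.sum_equiv (Function.Involutive.toPerm SimpleGraph.Dart.symm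
      SimpleGraph.Dart.symm_involutive) _ _ fun b => ?_
    simp [hy]
  have hne : a ≠ a.symm := (SimpleGraph.Dart.symm_ne a).symm
  rw [two_nsmul]
  nth_rewrite 2 [h1]
  rw [← Finset.sum_add_distrib, ← Finset.sum_subset (Finset.subset_univ {a, a.symm})]
  · rw [Finset.sum_pair hne]
    have h2 := fst_notMem_side hG a
    have h3 := snd_mem_side a
    simp [h2, h3, hy, two_nsmul]
  · intro b _ hb
    simp only [Finset.mem_insert, Finset.mem_singleton, not_or] at hb
    have := mem_side_iff_of_ne hb.1 hb.2
    by_cases h : b.snd ∈ side a <;> simp [this, h]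

end Sides

/-! ### The index of a triangular lattice -/

section Index

theorem index_closure_pair (a b : ℤ × ℤ) (h : det a b ≠ 0) :
    (AddSubgroup.closure {a, b}).index = (det a b).natAbs := by
  let v : Fin 2 → ℤ × ℤ := ![a, b]
  have hv : LinearIndependent ℤ v := by
    rw [LinearIndependent.pair_iff]
    intro s t hst
    have h1 := congrArg Prod.fst hst
    have h2 := congrArg Prod.snd hst
    simp only [Prod.fst_add, Prod.smul_fst, smul_eq_mul, Prod.fst_zero, Prod.snd_add,
      Prod.smul_snd, Prod.snd_zero] at h1 h2
    unfold det at h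
    constructor
    · have : s * (a.1 * b.2 - a.2 * b.1) = 0 := by linear_combination b.2 * h1 - b.1 * h2
      exact (mul_eq_zero.1 this).resolve_right h
    · have : t * (a.1 * b.2 - a.2 * b.1) = 0 := by linear_combination a.1 * h2 - a.2 * h1
      exact (mul_eq_zero.1 this).resolve_right h
  have hcl : (AddSubgroup.closure {a, b}) = (Submodule.span ℤ (Set.range v)).toAddSubgroup := by
    rw [Submodule.span_int_eq_addSubgroupClosure]
    congr 1
    simp [v, Matrix.range_cons]
    aesop
  rw [hcl]
  let e : Module.Basis (Fin 2) ℤ (ℤ × ℤ) :=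
    Module.Basis.ofEquivFun (LinearEquiv.finTwoArrow ℤ ℤ).symm
  have := AddSubgroup.index_eq_natAbs_det e (Submodule.span ℤ (Set.range v)).toAddSubgroup
    (Module.Basis.span hv)
  rw [this, Module.Basis.det_apply, Matrix.det_fin_two]
  have hb : ∀ i, ((Module.Basis.span hv i : Submodule.span ℤ (Set.range v)) : ℤ × ℤ) = v i :=
    fun i => congrArg Subtype.val (Module.Basis.span_apply hv i)
  simp only [Module.Basis.toMatrix_apply]
  have hb0 := hb 0
  have hb1 := hb 1
  erw [hb0, hb1]
  simp [e, v, det]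
  congr 1; ring

variable {V Q : Type}

/-- Pairs of a vector `y` and a solution `x`, supported in `S`, of the equations
`y q = x w - p q x` modulo `s q` at the vertices `w` of `S`; the two equations at `w` are
`σ (w, 0)` and `σ (w, 1)`. -/
def triangularPairs (σ : V × Fin 2 ≃ Q) (s : Q → ℤ × ℤ) (p : Q → (V → ℤ × ℤ) →+ ℤ × ℤ)
    (S : Finset V) : AddSubgroup ((Q → ℤ × ℤ) × (V → ℤ × ℤ)) where
  carrier := {z | (∀ v ∉ S, z.2 v = 0) ∧ ∀ w ∈ S, ∀ b, ∃ c : ℤ,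
    z.1 (σ (w, b)) = z.2 w - p (σ (w, b)) z.2 + c • s (σ (w, b))}
  zero_mem' := ⟨fun _ _ => rfl, fun _ _ _ => ⟨0, by simp⟩⟩
  add_mem' := by
    rintro z z' ⟨h1, h2⟩ ⟨h1', h2'⟩
    refine ⟨fun v hv => by simp [h1 v hv, h1' v hv], fun w hw b => ?_⟩
    obtain ⟨c, hc⟩ := h2 w hw b
    obtain ⟨c', hc'⟩ := h2' w hw b
    refine ⟨c + c', ?_⟩
    simp only [Prod.fst_add, Prod.snd_add, Pi.add_apply, map_add, hc, hc', add_smul]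
    abel
  neg_mem' := by
    rintro z ⟨h1, h2⟩
    refine ⟨fun v hv => by simp [h1 v hv], fun w hw b => ?_⟩
    obtain ⟨c, hc⟩ := h2 w hw b
    refine ⟨-c, ?_⟩
    simp only [Prod.fst_neg, Prod.snd_neg, Pi.neg_apply, map_neg, hc, neg_smul]
    abel

variable {σ : V × Fin 2 ≃ Q} {s : Q → ℤ × ℤ} {p : Q → (V → ℤ × ℤ) →+ ℤ × ℤ} {ht : V → ℕ}

theorem eq_zero_of_smul_eq_smul {a b : ℤ × ℤ} (h : det a b ≠ 0) {c d : ℤ}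
    (hcd : c • a = d • b) : c • a = 0 := by
  have h1 := congrArg Prod.fst hcd
  have h2 := congrArg Prod.snd hcd
  simp only [Prod.smul_fst, Prod.smul_snd, smul_eq_mul] at h1 h2
  unfold det at h
  have : c * (a.1 * b.2 - a.2 * b.1) = 0 := by linear_combination b.2 * h1 - b.1 * h2
  rw [(mul_eq_zero.1 this).resolve_right h, zero_smul]

/-- The solution of the triangular system is unique. -/
theorem snd_eq_zero_of_mem_triangularPairs
    (hp : ∀ w b x, (∀ v, ht v < ht w → x v = 0) → p (σ (w, b)) x = 0)
    (hdet : ∀ w, det (s (σ (w, 0))) (s (σ (w, 1))) ≠ 0) {S : Finset V} {x : V → ℤ × ℤ}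
    (hx : ((0 : Q → ℤ × ℤ), x) ∈ triangularPairs σ s p S) : x = 0 := by
  obtain ⟨h1, h2⟩ := hx
  have : ∀ N, ∀ w, ht w < N → x w = 0 := by
    intro N
    induction N with
    | zero => intro w hw; omega
    | succ N ih =>
      intro w hw
      by_cases hwS : w ∈ S
      · have hpw : ∀ b, p (σ (w, b)) x = 0 := fun b => hp w b x fun v hv => ih v (by omega)
        obtain ⟨c0, hc0⟩ := h2 w hwS 0
        obtain ⟨c1, hc1⟩ := h2 w hwS 1
        simp only [Pi.zero_apply, hpw, sub_zero] at hc0 hc1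
        have e0 : x w = (-c0) • s (σ (w, 0)) := by
          rw [neg_smul]; exact eq_neg_of_add_eq_zero_left hc0.symm
        have e1 : x w = (-c1) • s (σ (w, 1)) := by
          rw [neg_smul]; exact eq_neg_of_add_eq_zero_left hc1.symm
        rw [e0]
        exact eq_zero_of_smul_eq_smul (hdet w) (e0.symm.trans e1)
      · exact h1 w hwS
  funext w
  exact this (ht w + 1) w (by omega)

theorem index_map_fst_triangularPairs
    (hp : ∀ w b x, (∀ v, ht v < ht w → x v = 0) → p (σ (w, b)) x = 0)
    (hdet : ∀ w, det (s (σ (w, 0))) (s (σ (w, 1))) ≠ 0) (S : Finset V)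
    (hS : ∀ w ∈ S, ∀ v, ht v < ht w → v ∈ S) :
    ((triangularPairs σ s p S).map (AddMonoidHom.fst _ _)).index =
      ∏ w ∈ S, (det (s (σ (w, 0))) (s (σ (w, 1)))).natAbs := by
  classical
  induction S using Finset.induction_on_max_value ht with
  | empty =>
    rw [Finset.prod_empty, AddSubgroup.index_eq_one, eq_top_iff]
    intro y _
    exact ⟨(y, 0), ⟨fun _ _ => rfl, fun w hw => absurd hw (Finset.notMem_empty w)⟩, rfl⟩
  | insert w S hw hmax ih =>
    have hS' : ∀ v ∈ S, ∀ u, ht u < ht v → u ∈ S := by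
      intro v hv u hu
      rcases Finset.mem_insert.1 (hS v (Finset.mem_insert_of_mem hv) u hu) with rfl | h
      · have := hmax v hv; omega
      · exact h
    have hlow : ∀ v, ht v < ht w → v ∈ S := by
      intro v hv
      rcases Finset.mem_insert.1 (hS w (Finset.mem_insert_self _ _) v hv) with rfl | h
      · omega
      · exact h
    rw [Finset.prod_insert hw, ← ih hS']
    set T := triangularPairs σ s p S
    set T' := triangularPairs σ s p (insert w S)
    -- equations at vertices of `S` ignore the value at vertices outside `S`
    have hpS : ∀ v ∈ S, ∀ b, ∀ x x' : V → ℤ × ℤ, (∀ u ∈ S, x u = x' u) →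
        p (σ (v, b)) x = p (σ (v, b)) x' := by
      intro v hv b x x' hxx'
      rw [← sub_eq_zero, ← map_sub]
      refine hp v b _ fun u hu => ?_
      rw [Pi.sub_apply, hxx' u (hS' v hv u hu), sub_self]
    have hpw : ∀ b, ∀ x x' : V → ℤ × ℤ, (∀ u ∈ S, x u = x' u) →
        p (σ (w, b)) x = p (σ (w, b)) x' := by
      intro b x x' hxx'
      rw [← sub_eq_zero, ← map_sub]
      refine hp w b _ fun u hu => ?_
      rw [Pi.sub_apply, hxx' u (hlow u hu), sub_self]
    have hrestr : ∀ z ∈ T', (z.1, fun u => if u ∈ S then z.2 u else 0) ∈ T := by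
      rintro ⟨y, x⟩ ⟨-, h2⟩
      refine ⟨fun v hv => if_neg hv, fun v hv b => ?_⟩
      obtain ⟨c, hc⟩ := h2 v (Finset.mem_insert_of_mem hv) b
      refine ⟨c, ?_⟩
      simp only [if_pos hv]
      rw [hpS v hv b _ x fun u hu => if_pos hu]
      exact hc
    have hle : T'.map (AddMonoidHom.fst _ _) ≤ T.map (AddMonoidHom.fst _ _) := by
      rintro _ ⟨z, hz, rfl⟩
      exact ⟨_, hrestr z hz, rfl⟩
    rw [← AddSubgroup.relIndex_mul_index hle, ← AddSubgroup.relIndex_comap]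
    congr 1
    -- the obstruction to solving both equations at `w`
    let f : (Q → ℤ × ℤ) × (V → ℤ × ℤ) →+ ℤ × ℤ :=
      { toFun := fun z => (z.1 (σ (w, 0)) + p (σ (w, 0)) z.2) -
          (z.1 (σ (w, 1)) + p (σ (w, 1)) z.2)
        map_zero' := by simp
        map_add' := by intro z z'; simp; abel }
    have hf : Function.Surjective (f.comp T.subtype) := by
      intro u
      refine ⟨⟨(Pi.single (σ (w, 0)) u, 0), fun _ _ => rfl, fun v hv b => ⟨0, ?_⟩⟩, ?_⟩
      · have : σ (v, b) ≠ σ (w, 0) := by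
          intro h
          have := congrArg Prod.fst (σ.injective h)
          simp only at this
          exact hw (this ▸ hv)
        simp [this]
      · simp [f]
    have hker : ((T'.map (AddMonoidHom.fst _ _)).comap (AddMonoidHom.fst _ _)).addSubgroupOf T =
        (AddSubgroup.closure {s (σ (w, 0)), s (σ (w, 1))}).comap (f.comp T.subtype) := by
      ext ⟨⟨y, x⟩, hz⟩
      simp only [AddSubgroup.mem_addSubgroupOf, AddSubgroup.mem_comap, AddMonoidHom.coe_comp,
        AddSubgroup.coe_subtype, Function.comp_apply, AddSubgroup.mem_closure_pair]
      constructor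
      · rintro ⟨⟨y', x'⟩, hz', hy⟩
        have hy' : y' = y := hy
        subst hy'
        have hr := hrestr _ hz'
        have hxx : ∀ u ∈ S, x u = x' u := by
          have h0 := T.sub_mem hz hr
          rw [Prod.mk_sub_mk, sub_self] at h0
          have h0' := snd_eq_zero_of_mem_triangularPairs hp hdet h0
          intro u hu
          have := congrFun h0' u
          simp only [Pi.sub_apply, if_pos hu, Pi.zero_apply] at this
          exact sub_eq_zero.1 this
        obtain ⟨c0, hc0⟩ := hz'.2 w (Finset.mem_insert_self _ _) 0
        obtain ⟨c1, hc1⟩ := hz'.2 w (Finset.mem_insert_self _ _) 1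
        refine ⟨c0, -c1, ?_⟩
        simp only [f, AddMonoidHom.coe_mk, ZeroHom.coe_mk]
        simp only at hc0 hc1
        rw [hpw 0 x x' hxx, hpw 1 x x' hxx, hc0, hc1, neg_smul]
        abel
      · rintro ⟨a, b, hab⟩
        simp only [f, AddMonoidHom.coe_mk, ZeroHom.coe_mk] at hab
        let x' : V → ℤ × ℤ := Function.update x w
          (y (σ (w, 0)) + p (σ (w, 0)) x - a • s (σ (w, 0)))
        have hxx' : ∀ u ∈ S, x' u = x u := by
          intro u hu
          exact Function.update_of_ne (by rintro rfl; exact hw hu) _ _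
        have hx'w : x' w = y (σ (w, 0)) + p (σ (w, 0)) x - a • s (σ (w, 0)) :=
          Function.update_self _ _ _
        refine ⟨(y, x'), ⟨fun v hv => ?_, fun v hv c => ?_⟩, rfl⟩
        · have hvw : v ≠ w := by rintro rfl; exact hv (Finset.mem_insert_self _ _)
          have hvS : v ∉ S := fun h => hv (Finset.mem_insert_of_mem h)
          simp only [x', Function.update_of_ne hvw]
          exact hz.1 v hvS
        · rcases Finset.mem_insert.1 hv with rfl | hvS
          · simp only [hx'w]
            rw [hpw c x' x hxx']
            fin_cases c
            · refine ⟨a, ?_⟩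
              simp only [Fin.zero_eta]
              abel
            · refine ⟨-b, ?_⟩
              have : b • s (σ (v, 1)) = y (σ (v, 0)) + p (σ (v, 0)) x -
                  (y (σ (v, 1)) + p (σ (v, 1)) x) - a • s (σ (v, 0)) := by rw [← hab]; abel
              simp only [Fin.mk_one, neg_smul, this]
              abel
          · obtain ⟨c', hc'⟩ := hz.2 v hvS c
            refine ⟨c', ?_⟩
            simp only
            rw [hxx' v hvS, hpS v hvS c x' x hxx']
            exact hc'
    rw [← index_closure_pair _ _ (hdet w), ← AddSubgroup.index_comap_of_surjective _ hf, ← hker]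
    rfl

/-- The index of the lattice of the `y` for which the triangular system
`y q = x w - p q x` modulo `s q` has a solution `x`. -/
theorem index_triangular [Fintype V]
    (hp : ∀ w b x, (∀ v, ht v < ht w → x v = 0) → p (σ (w, b)) x = 0)
    (hdet : ∀ w, det (s (σ (w, 0))) (s (σ (w, 1))) ≠ 0) :
    ((triangularPairs σ s p Finset.univ).map (AddMonoidHom.fst _ _)).index =
      ∏ w, (det (s (σ (w, 0))) (s (σ (w, 1)))).natAbs :=
  index_map_fst_triangularPairs hp hdet Finset.univ fun _ _ v _ => Finset.mem_univ v

end Index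

/-! ### Slopes, valencies and the dimension count -/

section Counting

instance fintype_dart {ι V : Type} [Finite V] (Γ : AbstractCurve ι V) : Fintype Γ.graph.Dart :=
  Fintype.ofFinite _

instance fintype_edgeSet {ι V : Type} [Finite V] (Γ : AbstractCurve ι V) :
    Fintype Γ.graph.edgeSet :=
  Fintype.ofFinite _

theorem toReal_injective : Function.Injective toReal := by
  intro a b hab
  have h1 := congrArg Prod.fst hab
  have h2 := congrArg Prod.snd hab
  simp only [toReal, Int.cast_inj] at h1 h2
  exact Prod.ext h1 h2

@[simp] theorem toReal_zero : toReal 0 = 0 := by simp [toReal]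

theorem toReal_sub (a b : ℤ × ℤ) : toReal (a - b) = toReal a - toReal b := by
  simp [toReal]

theorem toReal_neg (a : ℤ × ℤ) : toReal (-a) = - toReal a := by
  simp [toReal]

variable {ι V : Type} [Finite V]

open Classical in
theorem AbstractCurve.sum_flag [Fintype ι] {M : Type*} [AddCommMonoid M]
    (Γ : AbstractCurve ι V) (v : V)
    (f : Γ.graph.Dart → M) (g : ι → M) :
    ∑ x : Γ.Flag v, Sum.elim (fun a => f a.1) (fun l => g l.1) x =
      (∑ a, if a.fst = v then f a else 0) + ∑ l, if Γ.endVertex l = v then g l else 0 := by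
  have : Γ.fintype_flag v = instFintypeSum _ _ := Subsingleton.elim _ _
  rw [this, Fintype.sum_sum_type, ← Finset.sum_filter, ← Finset.sum_filter]
  congr 1
  · exact (Finset.sum_subtype _ (by simp) f).symm
  · exact (Finset.sum_subtype _ (by simp) g).symm

theorem AbstractCurve.card_dart (Γ : AbstractCurve ι V) :
    Fintype.card Γ.graph.Dart = 2 * Fintype.card Γ.graph.edgeSet := by
  classical
  cases nonempty_fintype V
  have := Γ.graph.dart_card_eq_twice_card_edges
  rw [SimpleGraph.edgeFinset, Set.toFinset_card] at this
  convert this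

theorem AbstractCurve.card_edgeSet (Γ : AbstractCurve ι V) [Fintype V] :
    Fintype.card Γ.graph.edgeSet + 1 = Fintype.card V := by
  classical
  have := Γ.isTree.card_edgeFinset
  rw [SimpleGraph.edgeFinset_card] at this
  convert this

theorem AbstractCurve.sum_valency [Fintype ι] (Γ : AbstractCurve ι V) [Fintype V] :
    ∑ v, Γ.valency v = 2 * Fintype.card Γ.graph.edgeSet + Fintype.card ι := by
  classical
  have h1 : ∀ v, Γ.valency v = (∑ a : Γ.graph.Dart, if a.fst = v then 1 else 0) +
      ∑ l, if Γ.endVertex l = v then 1 else 0 := by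
    intro v
    rw [← Γ.sum_flag v (fun _ => 1) (fun _ => 1), AbstractCurve.valency]
    have : ∀ x : Γ.Flag v, Sum.elim (fun _ => 1) (fun _ => 1) x = 1 := by rintro (x | x) <;> rfl
    simp [this]
  rw [Finset.sum_congr rfl fun v _ => h1 v]
  have h2 : ∑ v, ∑ a : Γ.graph.Dart, (if a.fst = v then 1 else 0) =
      Fintype.card Γ.graph.Dart := by
    rw [Finset.sum_comm]; simp
  have h3 : ∑ v, ∑ l, (if Γ.endVertex l = v then 1 else 0) = Fintype.card ι := by
    rw [Finset.sum_comm]; simp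
  rw [Finset.sum_add_distrib, h2, h3, AbstractCurve.card_dart]

end Counting

namespace ParamCurve

variable {n r d : ℕ} {V : Type} [Fintype V] (h : ParamCurve n r d V) {k : Fin r → ℕ}

theorem slope_symm (a : h.graph.Dart) : h.slope a.symm = - h.slope a := by
  have h1 := h.affine a
  have h2 := h.affine a.symm
  have he : h.dartEdge a.symm = h.dartEdge a := Subtype.ext (SimpleGraph.Dart.edge_symm a)
  have hl := (h.length_pos (h.dartEdge a)).ne'
  rw [he] at h2
  apply toReal_injective
  rw [toReal_neg]
  have : h.length (h.dartEdge a) • toReal (h.slope a.symm) =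
      h.length (h.dartEdge a) • (- toReal (h.slope a)) := by
    rw [smul_neg, ← h1, ← h2]
    simp
  exact smul_right_injective _ hl this

open Classical in
/-- The slope along an oriented edge is the sum of the slopes of the ends beyond it. -/
theorem slope_eq_sum (a : h.graph.Dart) :
    h.slope a = ∑ l, if h.endVertex l ∈ side a then endSlope l else 0 := by
  have hbal : ∀ v, (∑ b : h.graph.Dart, if b.fst = v then h.slope b else 0) +
      (∑ l, if h.endVertex l = v then endSlope l else 0) = 0 := by
    intro v
    rw [← h.sum_flag v h.slope endSlope]
    exact h.balanced v
  have hsum : ∑ v, (if v ∈ side a then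
      ((∑ b : h.graph.Dart, if b.fst = v then h.slope b else 0) +
      (∑ l, if h.endVertex l = v then endSlope l else 0)) else 0) = 0 :=
    Finset.sum_eq_zero fun v _ => by rw [hbal, ite_self]
  have h1 : ∀ v, (if v ∈ side a then
      ((∑ b : h.graph.Dart, if b.fst = v then h.slope b else 0) +
      (∑ l, if h.endVertex l = v then endSlope l else 0)) else 0) =
      (∑ b : h.graph.Dart, if b.fst = v then (if b.fst ∈ side a then h.slope b else 0) else 0) +
      (∑ l, if h.endVertex l = v then
        (if h.endVertex l ∈ side a then endSlope l else 0) else 0) := by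
    intro v
    split_ifs with hv
    · congr 1
      · refine Finset.sum_congr rfl fun b _ => ?_
        by_cases hb : b.fst = v <;> simp [hb, hv]
      · refine Finset.sum_congr rfl fun l _ => ?_
        by_cases hb : h.endVertex l = v <;> simp [hb, hv]
    · symm
      rw [Finset.sum_eq_zero, Finset.sum_eq_zero, add_zero]
      · intro l _
        by_cases hb : h.endVertex l = v <;> simp [hb, hv]
      · intro b _
        by_cases hb : b.fst = v <;> simp [hb, hv]
  simp only [h1] at hsum
  rw [Finset.sum_add_distrib, Finset.sum_comm,
    Finset.sum_comm (f := fun v l => if h.endVertex l = v then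
        (if h.endVertex l ∈ side a then endSlope l else 0) else 0)] at hsum
  simp only [Finset.sum_ite_eq, Finset.mem_univ, if_true] at hsum
  have h2 := two_nsmul_sum_side h.isTree h.slope h.slope_symm a
  rw [← smul_neg] at h2
  have h3 := smul_right_injective (ℤ × ℤ) (two_ne_zero (α := ℕ)) h2
  rw [h3] at hsum
  exact (neg_add_eq_zero.1 hsum)

theorem sum_psiExponent_marksAt :
    ∑ v, ∑ m ∈ h.marksAt v, psiExponent k m = ∑ i, k i := by
  classical
  have : ∀ v, h.marksAt v = Finset.univ.filter fun m => h.markVertex m = v := by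
    intro v; ext m; simp [marksAt]
  simp only [this]
  rw [Finset.sum_fiberwise (g := h.markVertex)]
  simp [psiExponent, Fintype.sum_sum_type]

theorem card_label (n r d : ℕ) : Fintype.card (Label n r d) = n + r + 3 * d := by
  simp

theorem card_vertices_le (hdim : n + ∑ i, k i + 1 = 3 * d) (hk : h.InPsiFan k) :
    Fintype.card V + 1 ≤ 2 * n + r := by
  have h1 := h.sum_valency
  have h2 := h.card_edgeSet
  have h3 : ∑ v, (3 + ∑ m ∈ h.marksAt v, psiExponent k m) ≤ ∑ v, h.valency v :=
    Finset.sum_le_sum fun v _ => hk v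
  rw [Finset.sum_add_distrib, h.sum_psiExponent_marksAt, h1, card_label,
    Finset.sum_const, Finset.card_univ, smul_eq_mul] at h3
  omega

theorem inOpenTopCone_of_card_vertices (hdim : n + ∑ i, k i + 1 = 3 * d) (hk : h.InPsiFan k)
    (hV : Fintype.card V + 1 = 2 * n + r) : h.InOpenTopCone k := by
  have h1 := h.sum_valency
  have h2 := h.card_edgeSet
  have h3 : ∑ v, (3 + ∑ m ∈ h.marksAt v, psiExponent k m) = ∑ v, h.valency v := by
    rw [Finset.sum_add_distrib, h.sum_psiExponent_marksAt, h1, card_label, Finset.sum_const,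
      Finset.card_univ, smul_eq_mul]
    omega
  intro v
  exact ((Finset.sum_eq_sum_iff_of_le fun v _ => hk v).1 h3 v (Finset.mem_univ v)).symm

end ParamCurve

/-! ### Generic constraints -/

/-- A finite set of integral vectors containing the slopes of the edges of all curves of
degree `d`, the directions of the rays of a tropical line, and the standard basis. -/
def slopeSet (n r d : ℕ) : Set (ℤ × ℤ) :=
  Set.range (fun T : Finset (Label n r d) => ∑ l ∈ T, endSlope l) ∪
    (Set.range dir ∪ {(1, 0), (0, 1)})

theorem slopeSet_finite (n r d : ℕ) : (slopeSet n r d).Finite :=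
  (Set.finite_range _).union ((Set.finite_range _).union (Set.toFinite _))

theorem zero_mem_slopeSet (n r d : ℕ) : 0 ∈ slopeSet n r d := Or.inl ⟨∅, rfl⟩

/-- The tangent vectors of the space of constraints whose components are in `slopeSet`. -/
def generators (n r d : ℕ) : Set (Mark n r → ℝ × ℝ) :=
  (fun w m => toReal (w m)) '' Set.univ.pi fun _ : Mark n r => slopeSet n r d

theorem generators_finite (n r d : ℕ) : (generators n r d).Finite :=
  (Set.Finite.pi fun _ => slopeSet_finite n r d).image _

theorem exceptional_finite (n r d : ℕ) :
    {H : AffineSubspace ℝ (Mark n r → ℝ × ℝ) | H ≠ ⊤ ∧ ∃ T ⊆ generators n r d,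
      H = (Submodule.span ℝ T).toAffineSubspace}.Finite := by
  refine ((generators_finite n r d).finite_subsets.image
    fun T => (Submodule.span ℝ T).toAffineSubspace).subset ?_
  rintro H ⟨-, T, hT, rfl⟩
  exact ⟨T, hT, rfl⟩

/-- The proper linear subspaces spanned by some of the `generators`: the constraints outside these
subspaces are generic. -/
def exceptional (n r d : ℕ) : Finset (AffineSubspace ℝ (Mark n r → ℝ × ℝ)) :=
  (exceptional_finite n r d).toFinset

theorem span_eq_top_of_generic {n r d : ℕ} {ξ : Mark n r → ℝ × ℝ}
    (hξ : ∀ H ∈ exceptional n r d, ξ ∉ H) {T : Set (Mark n r → ℝ × ℝ)}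
    (hT : T ⊆ generators n r d) (h : ξ ∈ Submodule.span ℝ T) : Submodule.span ℝ T = ⊤ := by
  by_contra hne
  refine hξ (Submodule.span ℝ T).toAffineSubspace ?_ h
  rw [exceptional, Set.Finite.mem_toFinset]
  refine ⟨fun htop => hne ?_, T, hT, rfl⟩
  rw [eq_top_iff]
  intro x _
  have : x ∈ (Submodule.span ℝ T).toAffineSubspace := by rw [htop]; trivial
  exact this

namespace ParamCurve

variable {n r d : ℕ} {V : Type} [Fintype V] (h : ParamCurve n r d V) {k : Fin r → ℕ}

instance fintype_notMem_side (ρ : V) : Fintype {a : h.graph.Dart // ρ ∉ side a} :=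
  Fintype.ofFinite _

open Classical in
/-- Vectors spanning the sum of the image of the tangent space of the cone of `(Γ, h)` under
evaluation and of the lines with directions `s`: the translations, the variations of the lengths of
the edges, and the vectors along the lines. Edges are oriented away from the vertex `ρ`. -/
def tangent (ρ : V) (s : Fin r → Fin 3) :
    Fin 2 ⊕ {a : h.graph.Dart // ρ ∉ side a} ⊕ Fin r → Mark n r → ℤ × ℤ
  | Sum.inl b, _ => ![(1, 0), (0, 1)] b
  | Sum.inr (Sum.inl a), m => if h.markVertex m ∈ side a.1 then h.slope a.1 else 0
  | Sum.inr (Sum.inr i), m => if m = Sum.inr i then dir (s i) else 0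

theorem tangent_mem (ρ : V) (s : Fin r → Fin 3)
    (j : Fin 2 ⊕ {a : h.graph.Dart // ρ ∉ side a} ⊕ Fin r) :
    (fun m => toReal (h.tangent ρ s j m)) ∈ generators n r d := by
  classical
  refine ⟨h.tangent ρ s j, fun m _ => ?_, rfl⟩
  rcases j with b | a | i
  · right; right
    fin_cases b <;> simp [tangent]
  · simp only [tangent]
    split_ifs
    · left
      refine ⟨Finset.univ.filter fun l => h.endVertex l ∈ side a.1, ?_⟩
      simp only [h.slope_eq_sum, Finset.sum_filter]
    · exact zero_mem_slopeSet n r d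
  · simp only [tangent]
    split_ifs
    · right; left; exact ⟨_, rfl⟩
    · exact zero_mem_slopeSet n r d

theorem sum_tangent (ρ : V) (s : Fin r → Fin 3) (x : V → ℝ × ℝ) (y : h.graph.Dart → ℝ)
    (t : Fin r → ℝ) (hxy : ∀ a : h.graph.Dart, x a.snd - x a.fst = y a • toReal (h.slope a))
    (m : Mark n r) :
    ∑ j, (Sum.elim ![(x ρ).1, (x ρ).2] (Sum.elim (fun a => y a.1) fun i => - t i) : _ → ℝ) j •
      toReal (h.tangent ρ s j m) =
    x (h.markVertex m) - Sum.elim (fun _ => 0) (fun i => t i • toReal (dir (s i))) m := by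
  classical
  rw [Fintype.sum_sum_type, Fintype.sum_sum_type,
    eq_add_potential h.isTree ρ x _ hxy (h.markVertex m), ← add_assoc, sub_eq_add_neg]
  congr 1
  · congr 1
    · simp [tangent, toReal]
    · unfold potential
      simp only [Sum.elim_inr, Sum.elim_inl, tangent]
      rw [← Finset.sum_subtype (Finset.univ.filter fun a : h.graph.Dart => ρ ∉ side a)
        (by simp) (fun a => y a • toReal (if h.markVertex m ∈ side a then h.slope a else 0)),
        Finset.sum_filter]
      refine Finset.sum_congr rfl fun a _ => ?_
      by_cases h1 : ρ ∈ side a <;> by_cases h2 : h.markVertex m ∈ side a <;> simp [h1, h2]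
  · rcases m with j | i
    · simp [tangent]
    · simp only [Sum.elim_inr, tangent, Sum.inr.injEq]
      rw [Finset.sum_eq_single i]
      · simp
      · intro b _ hb
        simp [hb.symm]
      · simp

theorem card_notMem_side (ρ : V) :
    Fintype.card {a : h.graph.Dart // ρ ∉ side a} = Fintype.card h.graph.edgeSet := by
  refine Fintype.card_of_bijective (f := fun a => h.dartEdge a.1) ⟨?_, ?_⟩
  · rintro ⟨a, ha⟩ ⟨b, hb⟩ hab
    have : a.edge = b.edge := congrArg Subtype.val hab
    rcases (SimpleGraph.dart_edge_eq_iff a b).1 this with rfl | rfl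
    · rfl
    · exact absurd ((mem_side_symm_iff h.isTree b ρ).2 hb) ha
  · rintro ⟨e, he⟩
    induction e with | _ u v =>
    let a : h.graph.Dart := ⟨(u, v), he⟩
    by_cases ha : ρ ∈ side a
    · refine ⟨⟨a.symm, fun h' => (mem_side_symm_iff h.isTree a ρ).1 h' ha⟩, Subtype.ext ?_⟩
      exact SimpleGraph.Dart.edge_symm a
    · exact ⟨⟨a, ha⟩, rfl⟩

/-- The dimension count for generic constraints: solutions lie in cones of maximal dimension and
in the interior of the rays of the lines, and the evaluation map is transversal to the
constraints. -/
theorem exists_linearIndependent_tangent (hdim : n + ∑ i, k i + 1 = 3 * d)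
    {ξ : Mark n r → ℝ × ℝ} (hξ : ∀ H ∈ exceptional n r d, ξ ∉ H) (hs : h.IsSolution k ξ) (ρ : V) :
    Fintype.card V + 1 = 2 * n + r ∧ ∃ s : Fin r → Fin 3,
      (∀ i, h.pos (h.markVertex (Sum.inr i)) ∈ openRay (ξ (Sum.inr i)) (s i)) ∧
      LinearIndependent ℝ fun j m => toReal (h.tangent ρ s j m) := by
  classical
  have hline := hs.line
  choose s t ht hpos using hline
  let g := fun j m => toReal (h.tangent ρ s j m)
  let c : Fin 2 ⊕ {a : h.graph.Dart // ρ ∉ side a} ⊕ Fin r → ℝ :=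
    Sum.elim ![(h.pos ρ).1, (h.pos ρ).2]
      (Sum.elim (fun a => h.length (h.dartEdge a.1)) fun i => - t i)
  have hξc : ξ = ∑ j, c j • g j := by
    funext m
    rw [Finset.sum_apply]
    have := h.sum_tangent ρ s h.pos (fun a => h.length (h.dartEdge a)) t h.affine m
    refine Eq.trans ?_ this.symm
    rcases m with j | i
    · simp [hs.point]
    · simp [hpos]
  have hsub : ∀ Z, g '' Z ⊆ generators n r d := by
    rintro Z _ ⟨j, -, rfl⟩
    exact h.tangent_mem ρ s j
  have hspan : ∀ Z : Set _, (∀ j ∉ Z, c j = 0) → Submodule.span ℝ (g '' Z) = ⊤ := by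
    intro Z hZ
    refine span_eq_top_of_generic hξ (hsub Z) ?_
    rw [hξc]
    refine Submodule.sum_mem _ fun j _ => ?_
    by_cases hj : j ∈ Z
    · exact Submodule.smul_mem _ _ (Submodule.subset_span ⟨j, hj, rfl⟩)
    · rw [hZ j hj, zero_smul]; exact Submodule.zero_mem _
  have htop : Submodule.span ℝ (Set.range g) = ⊤ := by
    rw [← Set.image_univ]
    exact hspan _ fun j hj => absurd (Set.mem_univ j) hj
  have hfin : Module.finrank ℝ (Mark n r → ℝ × ℝ) = 2 * (n + r) := by
    simp [Module.finrank_pi_fintype]; ring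
  have hle : 2 * (n + r) ≤
      Fintype.card (Fin 2 ⊕ {a : h.graph.Dart // ρ ∉ side a} ⊕ Fin r) := by
    rw [← hfin, ← finrank_top ℝ (Mark n r → ℝ × ℝ), ← htop]
    exact finrank_range_le_card g
  have hcard : Fintype.card (Fin 2 ⊕ {a : h.graph.Dart // ρ ∉ side a} ⊕ Fin r) =
      Fintype.card V + 1 + r := by
    rw [Fintype.card_sum, Fintype.card_sum, h.card_notMem_side, ← h.card_edgeSet]
    simp; ring
  have hV := h.card_vertices_le hdim hs.psi
  have hV' : Fintype.card V + 1 = 2 * n + r := by omega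
  have hli : LinearIndependent ℝ g :=
    linearIndependent_of_top_le_span_of_card_eq_finrank htop.ge (by rw [hfin, hcard]; omega)
  refine ⟨hV', s, fun i => ⟨t i, lt_of_le_of_ne (ht i) fun h0 => ?_, hpos i⟩, hli⟩
  -- at an apex, the vectors other than the direction of the ray would suffice to span
  have h1 := hspan {Sum.inr (Sum.inr i)}ᶜ (by
    intro j hj
    rw [Set.mem_compl_iff, not_not, Set.mem_singleton_iff] at hj
    subst hj
    simp [c, ← h0])
  refine hli.notMem_span_image (s := {Sum.inr (Sum.inr i)}ᶜ) (x := Sum.inr (Sum.inr i))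
    (by simp) ?_
  rw [h1]; trivial

variable {ρ : V} {s : Fin r → Fin 3}

theorem slope_ne_zero (hli : LinearIndependent ℝ fun j m => toReal (h.tangent ρ s j m))
    (a : h.graph.Dart) : h.slope a ≠ 0 := by
  have key : ∀ b : h.graph.Dart, ρ ∉ side b → h.slope b ≠ 0 := by
    intro b hb h0
    refine hli.ne_zero (Sum.inr (Sum.inl ⟨b, hb⟩)) ?_
    funext m
    simp [tangent, h0]
  by_cases ha : ρ ∈ side a
  · have := key a.symm fun h' => (mem_side_symm_iff h.isTree a ρ).1 h' ha
    rwa [slope_symm, neg_ne_zero] at this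
  · exact key a ha

theorem exists_toReal_eq_smul {a b : ℤ × ℤ} (ha : a ≠ 0) (h : det a b = 0) :
    ∃ c : ℝ, toReal b = c • toReal a := by
  unfold det at h
  have h' : (a.1 : ℝ) * b.2 - a.2 * b.1 = 0 := by exact_mod_cast h
  by_cases h1 : a.1 = 0
  · have h2 : a.2 ≠ 0 := fun h2 => ha (Prod.ext h1 h2)
    have h2' : (a.2 : ℝ) ≠ 0 := by exact_mod_cast h2
    refine ⟨b.2 / a.2, Prod.ext ?_ ?_⟩
    · simp only [toReal, Prod.smul_fst, smul_eq_mul]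
      field_simp
      linarith
    · simp only [toReal, Prod.smul_snd, smul_eq_mul]
      field_simp
  · have h1' : (a.1 : ℝ) ≠ 0 := by exact_mod_cast h1
    refine ⟨b.1 / a.1, Prod.ext ?_ ?_⟩
    · simp only [toReal, Prod.smul_fst, smul_eq_mul]
      field_simp
    · simp only [toReal, Prod.smul_snd, smul_eq_mul]
      field_simp
      linarith

theorem dir_ne_zero (i : Fin 3) : dir i ≠ 0 := by
  fin_cases i <;> simp [dir]

/-- A solution with transversal evaluation map is rigid: an infinitesimal variation of the
positions of the vertices that respects the slopes of the edges and the constraints is zero. -/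
theorem eq_zero_of_det_eq_zero
    (hli : LinearIndependent ℝ fun j m => toReal (h.tangent ρ s j m)) {x : V → ℤ × ℤ}
    (hedge : ∀ a : h.graph.Dart, det (h.slope a) (x a.snd - x a.fst) = 0)
    (hray : ∀ i, det (dir (s i)) (x (h.markVertex (Sum.inr i))) = 0)
    (hpoint : ∀ j, x (h.markVertex (Sum.inl j)) = 0) : x = 0 := by
  have h1 : ∀ a : h.graph.Dart, ∃ c : ℝ, toReal (x a.snd) - toReal (x a.fst) =
      c • toReal (h.slope a) := by
    intro a
    rw [← toReal_sub]
    exact exists_toReal_eq_smul (h.slope_ne_zero hli a) (hedge a)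
  choose y hy using h1
  choose t ht using fun i => exists_toReal_eq_smul (dir_ne_zero (s i)) (hray i)
  have hsum := fun m => h.sum_tangent ρ s (fun v => toReal (x v)) y t hy m
  have hz := Fintype.linearIndependent_iff.1 hli _ (by
    funext m
    rw [Finset.sum_apply]
    refine (hsum m).trans ?_
    rcases m with j | i
    · simp [hpoint]
    · simp [ht])
  have hρ : x ρ = 0 := by
    have h0 := hz (Sum.inl 0)
    have h0' := hz (Sum.inl 1)
    simp [toReal] at h0 h0'
    exact Prod.ext h0 h0'
  have hy0 : ∀ a : h.graph.Dart, x a.snd - x a.fst = 0 := by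
    have key : ∀ a : h.graph.Dart, ρ ∉ side a → x a.snd - x a.fst = 0 := by
      intro a ha
      have h0 := hz (Sum.inr (Sum.inl ⟨a, ha⟩))
      simp only [Sum.elim_inr, Sum.elim_inl] at h0
      apply toReal_injective
      rw [toReal_sub, hy a, h0, zero_smul, toReal_zero]
    intro a
    by_cases ha : ρ ∈ side a
    · have := key a.symm fun h' => (mem_side_symm_iff h.isTree a ρ).1 h' ha
      rw [← neg_sub, neg_eq_zero]
      simpa using this
    · exact key a ha
  funext v
  have := eq_add_potential h.isTree ρ x (fun _ => 0) hy0 v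
  rw [this, hρ, zero_add]
  simp [potential]

end ParamCurve

/-! ### The orientation of the edges -/

/-- If linear forms on `ℤ²`-valued functions on `V` have no common zero and there are twice as many
of them as elements of `V`, they can be distributed, two to each element, in such a way that each
form depends on the value at the element it is given to: the determinant of the forms has a nonzero
term in its Leibniz expansion. -/
theorem exists_slots {V Q : Type} [Fintype V] [Fintype Q] [DecidableEq V]
    (hcard : 2 * Fintype.card V = Fintype.card Q) (L : Q → (V → ℤ × ℤ) →+ ℤ)
    (hL : ∀ x, (∀ q, L q x = 0) → x = 0) :
    ∃ σ : V × Fin 2 ≃ Q, ∀ w b, ∃ u, L (σ (w, b)) (Pi.single w u) ≠ 0 := by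
  classical
  let e : V × Fin 2 ≃ Q := Fintype.equivOfCardEq (by simp [← hcard]; ring)
  let bas : Fin 2 → ℤ × ℤ := ![(1, 0), (0, 1)]
  let M : Matrix (V × Fin 2) (V × Fin 2) ℤ := fun i c => L (e i) (Pi.single c.1 (bas c.2))
  have hM : M.det ≠ 0 := by
    intro h0
    obtain ⟨w, hw, hMw⟩ := Matrix.exists_mulVec_eq_zero_iff.2 h0
    have hx : (∑ c, w c • (Pi.single c.1 (bas c.2) : V → ℤ × ℤ)) =
        fun v => (w (v, 0), w (v, 1)) := by
      funext v
      rw [Finset.sum_apply, Fintype.sum_prod_type, Finset.sum_eq_single v]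
      · rw [Fin.sum_univ_two]
        simp only [Pi.smul_apply, Pi.single_eq_same]
        refine Prod.ext ?_ ?_ <;>
          simp only [bas, Prod.fst_add, Prod.snd_add, Prod.smul_fst, Prod.smul_snd, smul_eq_mul,
            Matrix.cons_val_zero, Matrix.cons_val_one, mul_one, mul_zero, add_zero, zero_add]
      · intro u _ hu
        simp [hu.symm]
      · simp
    have hz := hL (fun v => (w (v, 0), w (v, 1))) (by
      intro q
      have h1 := congrFun hMw (e.symm q)
      rw [← hx, map_sum]
      simp only [Matrix.mulVec, dotProduct, M, Equiv.apply_symm_apply, Pi.zero_apply] at h1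
      rw [← h1]
      refine Finset.sum_congr rfl fun c _ => ?_
      rw [map_zsmul, smul_eq_mul, mul_comm])
    apply hw
    funext ⟨v, b⟩
    have h2 := congrFun hz v
    fin_cases b
    · exact congrArg Prod.fst h2
    · exact congrArg Prod.snd h2
  rw [Matrix.det_apply] at hM
  obtain ⟨π, -, hπ⟩ := Finset.exists_ne_zero_of_sum_ne_zero hM
  have hprod : ∏ i, M (π i) i ≠ 0 := fun h0 => hπ (by rw [h0, smul_zero])
  refine ⟨π.trans e, fun w b => ⟨bas b, ?_⟩⟩
  exact Finset.prod_ne_zero_iff.1 hprod (w, b) (Finset.mem_univ _)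

namespace ParamCurve

variable {n r d : ℕ} {V : Type} [Fintype V] (h : ParamCurve n r d V) {k : Fin r → ℕ}

/-- The scalar conditions on the positions of the vertices: one for each bounded edge (its slope),
one for each line constraint, and two for each point constraint. -/
abbrev Condition : Type := h.graph.edgeSet ⊕ Fin r ⊕ (Fin n × Fin 2)

/-- The vertices whose positions are involved in a condition. -/
def OnVertex : h.Condition → V → Prop
  | Sum.inl e, v => v ∈ e.1
  | Sum.inr (Sum.inl i), v => h.markVertex (Sum.inr i) = v
  | Sum.inr (Sum.inr j), v => h.markVertex (Sum.inl j.1) = v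

/-- A distribution of the conditions among the vertices, two to each vertex. It amounts to an
orientation of the bounded edges, each towards the vertex it is given to, with two incoming edges
at each vertex without marked points, one at each line constraint and none at each point
constraint. -/
structure Flow where
  /-- the two conditions given to each vertex -/
  slots : V × Fin 2 ≃ h.Condition
  onVertex : ∀ w b, h.OnVertex (slots (w, b)) w

theorem det_add (a b c : ℤ × ℤ) : det a (b + c) = det a b + det a c := by
  simp [det]; ring

theorem det_zero (a : ℤ × ℤ) : det a 0 = 0 := by simp [det]

theorem exists_dart (e : h.graph.edgeSet) : ∃ a : h.graph.Dart, h.dartEdge a = e := by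
  obtain ⟨e, he⟩ := e
  induction e with | _ u v => exact ⟨⟨(u, v), he⟩, rfl⟩

theorem dartEdge_eq_iff {a b : h.graph.Dart} :
    h.dartEdge a = h.dartEdge b ↔ a = b ∨ a = b.symm :=
  Subtype.ext_iff.trans (SimpleGraph.dart_edge_eq_iff a b)

theorem exists_flow (hV : Fintype.card V + 1 = 2 * n + r) {ρ : V} {s : Fin r → Fin 3}
    (hli : LinearIndependent ℝ fun j m => toReal (h.tangent ρ s j m)) : Nonempty h.Flow := by
  classical
  choose a ha using h.exists_dart
  let lin (u : ℤ × ℤ) (f : (V → ℤ × ℤ) →+ ℤ × ℤ) : (V → ℤ × ℤ) →+ ℤ :=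
    { toFun := fun x => det u (f x)
      map_zero' := by rw [map_zero, det_zero]
      map_add' := by intro x y; rw [map_add, det_add] }
  let ev (v : V) : (V → ℤ × ℤ) →+ ℤ × ℤ := Pi.evalAddMonoidHom _ v
  let L : h.Condition → (V → ℤ × ℤ) →+ ℤ :=
    Sum.elim (fun e => lin (h.slope (a e)) (ev (a e).snd - ev (a e).fst))
      (Sum.elim (fun i => lin (dir (s i)) (ev (h.markVertex (Sum.inr i))))
        fun j => lin (![(1, 0), (0, 1)] j.2) (ev (h.markVertex (Sum.inl j.1))))
  have hcard : 2 * Fintype.card V = Fintype.card h.Condition := by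
    have := h.card_edgeSet
    simp only [Fintype.card_sum, Fintype.card_prod, Fintype.card_fin]
    omega
  obtain ⟨σ, hσ⟩ := exists_slots hcard L (by
    intro x hx
    refine h.eq_zero_of_det_eq_zero hli ?_ (fun i => hx (Sum.inr (Sum.inl i))) ?_
    · intro b
      have h1 : det (h.slope (a (h.dartEdge b)))
        (x (a (h.dartEdge b)).snd - x (a (h.dartEdge b)).fst) = 0 := hx (Sum.inl (h.dartEdge b))
      rcases h.dartEdge_eq_iff.1 (ha (h.dartEdge b)) with hb | hb
      · rwa [hb] at h1
      · rw [hb, slope_symm] at h1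
        simp only [SimpleGraph.Dart.symm_toProd, Prod.fst_swap, Prod.snd_swap] at h1
        rw [← h1]
        simp only [det, Prod.fst_sub, Prod.snd_sub, Prod.fst_neg, Prod.snd_neg]
        ring
    · intro j
      have h1 : det (1, 0) (x (h.markVertex (Sum.inl j))) = 0 := hx (Sum.inr (Sum.inr (j, 0)))
      have h2 : det (0, 1) (x (h.markVertex (Sum.inl j))) = 0 := hx (Sum.inr (Sum.inr (j, 1)))
      simp [det] at h1 h2
      exact Prod.ext h2 h1)
  refine ⟨⟨σ, fun w b => ?_⟩⟩
  obtain ⟨u, hu⟩ := hσ w b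
  by_contra hcon
  apply hu
  generalize σ (w, b) = q at hcon
  rcases q with e | i | j
  · have hmem : ∀ v, (v = (a e).fst ∨ v = (a e).snd) → v ∈ e.1 := by
      intro v hv
      have : e.1 = s((a e).fst, (a e).snd) := by
        conv_lhs => rw [← ha e]
        rfl
      rw [this, Sym2.mem_iff]; exact hv
    have h1 : (a e).fst ≠ w := fun h' => hcon (hmem w (Or.inl h'.symm))
    have h2 : (a e).snd ≠ w := fun h' => hcon (hmem w (Or.inr h'.symm))
    change det _ ((Pi.single w u : V → ℤ × ℤ) (a e).snd - (Pi.single w u : V → ℤ × ℤ) (a e).fst) = 0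
    rw [Pi.single_eq_of_ne h1, Pi.single_eq_of_ne h2, sub_zero, det_zero]
  · change det _ ((Pi.single w u : V → ℤ × ℤ) _) = 0
    rw [Pi.single_eq_of_ne hcon, det_zero]
  · change det _ ((Pi.single w u : V → ℤ × ℤ) _) = 0
    rw [Pi.single_eq_of_ne hcon, det_zero]

namespace Flow

variable {h} (F : h.Flow)

/-- The vertex a bounded edge points to. -/
def tgt (e : h.graph.edgeSet) : V := (F.slots.symm (Sum.inl e)).1

theorem onVertex' (q : h.Condition) : h.OnVertex q (F.slots.symm q).1 := by
  have := F.onVertex (F.slots.symm q).1 (F.slots.symm q).2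
  rwa [Prod.mk.eta, Equiv.apply_symm_apply] at this

theorem tgt_mem (e : h.graph.edgeSet) : F.tgt e ∈ e.1 := F.onVertex' (Sum.inl e)

theorem exists_dart_snd_eq (e : h.graph.edgeSet) :
    ∃ a : h.graph.Dart, h.dartEdge a = e ∧ a.snd = F.tgt e := by
  obtain ⟨a, ha⟩ := h.exists_dart e
  have hm := F.tgt_mem e
  have : e.1 = s(a.fst, a.snd) := by
    rw [← ha]; rfl
  rw [this, Sym2.mem_iff] at hm
  rcases hm with hm | hm
  · exact ⟨a.symm, by rw [h.dartEdge_eq_iff.2 (Or.inr rfl), ha], hm.symm⟩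
  · exact ⟨a, ha, hm.symm⟩

/-- A bounded edge with its orientation. -/
def dart (e : h.graph.edgeSet) : h.graph.Dart := (F.exists_dart_snd_eq e).choose

@[simp] theorem dartEdge_dart (e : h.graph.edgeSet) : h.dartEdge (F.dart e) = e :=
  (F.exists_dart_snd_eq e).choose_spec.1

@[simp] theorem dart_snd (e : h.graph.edgeSet) : (F.dart e).snd = F.tgt e :=
  (F.exists_dart_snd_eq e).choose_spec.2

theorem mem_edge_iff (e : h.graph.edgeSet) (v : V) :
    v ∈ e.1 ↔ v = (F.dart e).fst ∨ v = F.tgt e := by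
  have : e.1 = s((F.dart e).fst, (F.dart e).snd) := by
    conv_lhs => rw [← F.dartEdge_dart e]
    rfl
  rw [this, Sym2.mem_iff, dart_snd]

theorem eq_dart_or_eq_symm (a : h.graph.Dart) :
    a = F.dart (h.dartEdge a) ∨ a = (F.dart (h.dartEdge a)).symm :=
  h.dartEdge_eq_iff.1 (F.dartEdge_dart _).symm

open Classical in
/-- The number of oriented edges that have a given vertex in front of them. It increases along
oriented edges, because in a tree an edge cannot be passed twice in the same direction. -/
def height (v : V) : ℕ := (Finset.univ.filter fun e => v ∈ side (F.dart e)).card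

theorem height_lt (e : h.graph.edgeSet) : F.height (F.dart e).fst < F.height (F.tgt e) := by
  classical
  refine Finset.card_lt_card ?_
  rw [Finset.ssubset_iff_of_subset]
  · refine ⟨e, ?_, ?_⟩
    · rw [Finset.mem_filter, ← dart_snd]
      exact ⟨Finset.mem_univ _, snd_mem_side _⟩
    · rw [Finset.mem_filter]
      exact fun h' => fst_notMem_side h.isTree _ h'.2
  · intro e' he'
    rw [Finset.mem_filter] at he' ⊢
    refine ⟨Finset.mem_univ _, ?_⟩
    rw [← dart_snd]
    by_cases h1 : F.dart e = F.dart e'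
    · rw [h1]; exact snd_mem_side _
    by_cases h2 : F.dart e = (F.dart e').symm
    · exfalso
      have h3 : e = e' := by
        rw [← F.dartEdge_dart e, ← F.dartEdge_dart e']
        exact h.dartEdge_eq_iff.2 (Or.inr h2)
      exact h1 (by rw [h3])
    · exact (mem_side_iff_of_ne h1 h2).1 he'.2

theorem height_le (v : V) : F.height v ≤ Fintype.card h.graph.edgeSet :=
  Finset.card_le_univ _

/-! ### Incoming edges -/

theorem slots_symm_point (j : Fin n) (b : Fin 2) :
    (F.slots.symm (Sum.inr (Sum.inr (j, b)))).1 = h.markVertex (Sum.inl j) :=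
  (F.onVertex' (Sum.inr (Sum.inr (j, b)))).symm

theorem slots_symm_line (i : Fin r) :
    (F.slots.symm (Sum.inr (Sum.inl i))).1 = h.markVertex (Sum.inr i) :=
  (F.onVertex' (Sum.inr (Sum.inl i))).symm

/-- A point constraint fills both places at its vertex. -/
theorem slots_point (j : Fin n) (q : h.Condition)
    (hq : (F.slots.symm q).1 = h.markVertex (Sum.inl j)) :
    ∃ b, q = Sum.inr (Sum.inr (j, b)) := by
  have h0 := F.slots_symm_point j 0
  have h1 := F.slots_symm_point j 1
  have hne : (F.slots.symm (Sum.inr (Sum.inr (j, 0)))).2 ≠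
      (F.slots.symm (Sum.inr (Sum.inr (j, 1)))).2 := by
    intro h'
    have := F.slots.symm.injective (Prod.ext (h0.trans h1.symm) h')
    simp at this
  have : (F.slots.symm q).2 = (F.slots.symm (Sum.inr (Sum.inr (j, 0)))).2 ∨
      (F.slots.symm q).2 = (F.slots.symm (Sum.inr (Sum.inr (j, 1)))).2 := by omega
  rcases this with h' | h'
  · exact ⟨0, F.slots.symm.injective (Prod.ext (hq.trans h0.symm) h')⟩
  · exact ⟨1, F.slots.symm.injective (Prod.ext (hq.trans h1.symm) h')⟩

theorem tgt_ne_point (e : h.graph.edgeSet) (j : Fin n) :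
    F.tgt e ≠ h.markVertex (Sum.inl j) := by
  intro h'
  obtain ⟨b, hb⟩ := F.slots_point j _ h'
  cases hb

theorem markVertex_line_ne_point (F : h.Flow) (i : Fin r) (j : Fin n) :
    h.markVertex (Sum.inr i) ≠ h.markVertex (Sum.inl j) := by
  intro h'
  obtain ⟨b, hb⟩ := F.slots_point j _ ((F.slots_symm_line i).trans h')
  cases hb

/-- At the vertex of a line constraint there is exactly one incoming edge. -/
theorem exists_slots_line (hinj : Function.Injective fun i : Fin r => h.markVertex (Sum.inr i))
    (i : Fin r) : ∃ e : h.graph.edgeSet, ∃ b b' : Fin 2, b ≠ b' ∧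
      F.slots (h.markVertex (Sum.inr i), b) = Sum.inl e ∧
      F.slots (h.markVertex (Sum.inr i), b') = Sum.inr (Sum.inl i) := by
  have hi := F.slots_symm_line i
  set b' := (F.slots.symm (Sum.inr (Sum.inl i))).2 with hb'
  have h1 : F.slots (h.markVertex (Sum.inr i), b') = Sum.inr (Sum.inl i) := by
    rw [← hi, hb', Prod.mk.eta, Equiv.apply_symm_apply]
  obtain ⟨b, hb⟩ : ∃ b : Fin 2, b ≠ b' := exists_ne b'
  have hon := F.onVertex (h.markVertex (Sum.inr i)) b
  rcases hq : F.slots (h.markVertex (Sum.inr i), b) with e | i' | j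
  · exact ⟨e, b, b', hb, hq, h1⟩
  · rw [hq] at hon
    have : i' = i := hinj hon
    subst this
    have := F.slots.injective (hq.trans h1.symm)
    exact absurd (congrArg Prod.snd this) hb
  · rw [hq] at hon
    exact absurd hon.symm (F.markVertex_line_ne_point i j.1)

variable (hinj : Function.Injective fun i : Fin r => h.markVertex (Sum.inr i))

/-- The incoming edge at the vertex of a line constraint. -/
def inEdge (i : Fin r) : h.graph.edgeSet := (F.exists_slots_line hinj i).choose

theorem tgt_eq_of_slots {w : V} {b : Fin 2} {e : h.graph.edgeSet}
    (hq : F.slots (w, b) = Sum.inl e) : F.tgt e = w := by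
  rw [tgt, ← hq, Equiv.symm_apply_apply]

@[simp] theorem tgt_inEdge (i : Fin r) : F.tgt (F.inEdge hinj i) = h.markVertex (Sum.inr i) := by
  obtain ⟨b, b', -, hq, -⟩ := (F.exists_slots_line hinj i).choose_spec
  exact F.tgt_eq_of_slots hq

theorem eq_inEdge {e : h.graph.edgeSet} {i : Fin r} (he : F.tgt e = h.markVertex (Sum.inr i)) :
    e = F.inEdge hinj i := by
  obtain ⟨b, b', hb, hq, hq'⟩ := (F.exists_slots_line hinj i).choose_spec
  have h1 : F.slots (h.markVertex (Sum.inr i), (F.slots.symm (Sum.inl e)).2) = Sum.inl e := by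
    rw [← he, tgt, Prod.mk.eta, Equiv.apply_symm_apply]
  have : (F.slots.symm (Sum.inl e)).2 = b ∨ (F.slots.symm (Sum.inl e)).2 = b' := by omega
  rcases this with h' | h'
  · rw [h', hq] at h1
    exact (Sum.inl.inj h1).symm
  · rw [h', hq'] at h1
    cases h1

theorem not_marked_of_marksAt {v : V} (hv : h.marksAt v = ∅) (m : Mark n r) :
    h.markVertex m ≠ v := by
  intro h'
  have : m ∈ h.marksAt v := by simp [marksAt, h']
  rw [hv] at this
  simp at this

theorem exists_slots_unmarked {v : V} (hv : h.marksAt v = ∅) (b : Fin 2) :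
    ∃ e : h.graph.edgeSet, F.slots (v, b) = Sum.inl e := by
  have hon := F.onVertex v b
  rcases hq : F.slots (v, b) with e | i | j
  · exact ⟨e, rfl⟩
  · rw [hq] at hon
    exact absurd hon (not_marked_of_marksAt hv _)
  · rw [hq] at hon
    exact absurd hon (not_marked_of_marksAt hv _)

theorem eq_of_tgt_eq {v : V} {e0 e1 e : h.graph.edgeSet}
    (h0 : F.slots (v, 0) = Sum.inl e0) (h1 : F.slots (v, 1) = Sum.inl e1) (he : F.tgt e = v) :
    e = e0 ∨ e = e1 := by
  have h2 : F.slots (v, (F.slots.symm (Sum.inl e)).2) = Sum.inl e := by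
    rw [← he, tgt, Prod.mk.eta, Equiv.apply_symm_apply]
  have : (F.slots.symm (Sum.inl e)).2 = 0 ∨ (F.slots.symm (Sum.inl e)).2 = 1 := by omega
  rcases this with h' | h'
  · rw [h', h0] at h2
    exact Or.inl (Sum.inl.inj h2).symm
  · rw [h', h1] at h2
    exact Or.inr (Sum.inl.inj h2).symm

end Flow

end ParamCurve

/-! ### Vertices without marked points -/

theorem exists_third {α : Type*} [Fintype α] (hα : Fintype.card α = 3) {a b : α} (hab : a ≠ b) :
    ∃ c, c ≠ a ∧ c ≠ b ∧ ∀ x, x = a ∨ x = b ∨ x = c := by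
  classical
  have h1 : ((Finset.univ.erase a).erase b).card = 1 := by
    rw [Finset.card_erase_of_mem (by simp [hab.symm]), Finset.card_erase_of_mem (by simp),
      Finset.card_univ, hα]
  obtain ⟨c, hc⟩ := Finset.card_eq_one.1 h1
  have hmem : ∀ x, x ∈ (Finset.univ.erase a).erase b ↔ x = c := by
    intro x; rw [hc, Finset.mem_singleton]
  have hc' := (hmem c).2 rfl
  simp only [Finset.mem_erase, Finset.mem_univ, and_true] at hc' hmem
  refine ⟨c, hc'.2, hc'.1, fun x => ?_⟩
  by_cases hxa : x = a
  · exact Or.inl hxa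
  by_cases hxb : x = b
  · exact Or.inr (Or.inl hxb)
  · exact Or.inr (Or.inr ((hmem x).1 ⟨hxb, hxa⟩))

namespace ParamCurve

variable {n r d : ℕ} {V : Type} [Fintype V] {h : ParamCurve n r d V} {k : Fin r → ℕ}

theorem valency_of_marksAt (htop : h.InOpenTopCone k) {v : V} (hv : h.marksAt v = ∅) :
    Fintype.card (h.Flag v) = 3 := by
  have := htop v
  rwa [hv, Finset.sum_empty] at this

/-- The edge of a flag at a vertex without marked points. -/
def flagEdge {v : V} (hv : h.marksAt v = ∅) : h.Flag v → h.Edge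
  | Sum.inl a => Sum.inl (h.dartEdge a.1)
  | Sum.inr ⟨Sum.inr j, _⟩ => Sum.inr j
  | Sum.inr ⟨Sum.inl m, hm⟩ => absurd hm (Flow.not_marked_of_marksAt hv m)

theorem flagEdge_injective {v : V} (hv : h.marksAt v = ∅) :
    Function.Injective (flagEdge hv) := by
  rintro (⟨a, ha⟩ | ⟨m | j, hm⟩) (⟨b, hb⟩ | ⟨m' | j', hm'⟩) hab
  · have hab' : h.dartEdge a = h.dartEdge b := Sum.inl.inj hab
    rcases h.dartEdge_eq_iff.1 hab' with rfl | rfl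
    · rfl
    · exact absurd (hb.trans ha.symm) b.adj.ne
  · exact absurd hm' (Flow.not_marked_of_marksAt hv m')
  · cases hab
  · exact absurd hm (Flow.not_marked_of_marksAt hv m)
  · exact absurd hm (Flow.not_marked_of_marksAt hv m)
  · exact absurd hm (Flow.not_marked_of_marksAt hv m)
  · cases hab
  · exact absurd hm' (Flow.not_marked_of_marksAt hv m')
  · have : j = j' := Sum.inr.inj hab
    subst this
    rfl

theorem incident_iff_exists_flag {v : V} (hv : h.marksAt v = ∅) (f : h.Edge) :
    h.Incident v f ↔ ∃ x : h.Flag v, flagEdge hv x = f := by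
  constructor
  · intro hf
    rcases f with e | j
    · obtain ⟨a, rfl⟩ := h.exists_dart e
      have hm : v ∈ s(a.fst, a.snd) := hf
      rw [Sym2.mem_iff] at hm
      rcases hm with hm | hm
      · exact ⟨Sum.inl ⟨a, hm.symm⟩, rfl⟩
      · exact ⟨Sum.inl ⟨a.symm, hm.symm⟩, congrArg Sum.inl (h.dartEdge_eq_iff.2 (Or.inr rfl))⟩
    · exact ⟨Sum.inr ⟨Sum.inr j, hf⟩, rfl⟩
  · rintro ⟨x, rfl⟩
    rcases x with ⟨a, ha⟩ | ⟨m | j, hm⟩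
    · change v ∈ s(a.fst, a.snd)
      rw [Sym2.mem_iff]; exact Or.inl ha.symm
    · exact absurd hm (Flow.not_marked_of_marksAt hv m)
    · exact hm

namespace Flow

variable (F : h.Flow)

/-- The edge `f` points to the vertex `v`; ends point outwards. -/
def Into (v : V) : h.Edge → Prop := Sum.elim (fun e => F.tgt e = v) fun _ => False

/-- The edge `f` is adjacent to the vertex `v` and points away from it. -/
def Out (v : V) (f : h.Edge) : Prop := h.Incident v f ∧ ¬ F.Into v f

theorem incident_of_into {v : V} {f : h.Edge} (hf : F.Into v f) : h.Incident v f := by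
  rcases f with e | j
  · have : F.tgt e = v := hf
    subst this
    exact F.tgt_mem e
  · exact hf.elim

theorem existsUnique_out (htop : h.InOpenTopCone k) {v : V} (hv : h.marksAt v = ∅) :
    ∃! f, F.Out v f := by
  obtain ⟨e0, h0⟩ := F.exists_slots_unmarked hv 0
  obtain ⟨e1, h1⟩ := F.exists_slots_unmarked hv 1
  have t0 : F.Into v (Sum.inl e0) := F.tgt_eq_of_slots h0
  have t1 : F.Into v (Sum.inl e1) := F.tgt_eq_of_slots h1
  have hne : e0 ≠ e1 := by
    rintro rfl
    have := congrArg Prod.snd (F.slots.injective (h0.trans h1.symm))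
    simp at this
  obtain ⟨x0, hx0⟩ := (incident_iff_exists_flag hv _).1 (F.incident_of_into t0)
  obtain ⟨x1, hx1⟩ := (incident_iff_exists_flag hv _).1 (F.incident_of_into t1)
  have hx01 : x0 ≠ x1 := by
    rintro rfl
    exact hne (Sum.inl.inj (hx0.symm.trans hx1))
  obtain ⟨y, hy0, hy1, hy⟩ := exists_third (valency_of_marksAt htop hv) hx01
  refine ⟨flagEdge hv y, ⟨(incident_iff_exists_flag hv _).2 ⟨y, rfl⟩, fun hy' => ?_⟩, ?_⟩
  · rcases hf : flagEdge hv y with e | j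
    · rw [hf] at hy'
      rcases F.eq_of_tgt_eq h0 h1 hy' with rfl | rfl
      · exact hy0 (flagEdge_injective hv (hf.trans hx0.symm))
      · exact hy1 (flagEdge_injective hv (hf.trans hx1.symm))
    · rw [hf] at hy'
      exact hy'
  · rintro f ⟨hf, hf'⟩
    obtain ⟨x, rfl⟩ := (incident_iff_exists_flag hv _).1 hf
    rcases hy x with rfl | rfl | rfl
    · rw [hx0] at hf'; exact absurd t0 hf'
    · rw [hx1] at hf'; exact absurd t1 hf'
    · rfl

/-! ### The components of the complement of the marked points -/

open Classical in
/-- The edge that follows `f` in its component of the complement of the marked points, or `f`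
itself if `f` is an end or points to a marked vertex. -/
def next (f : h.Edge) : h.Edge :=
  if hf : ∃ f' v, F.Into v f ∧ h.marksAt v = ∅ ∧ F.Out v f' then hf.choose else f

theorem into_unique {v w : V} {f : h.Edge} (hv : F.Into v f) (hw : F.Into w f) : v = w := by
  rcases f with e | j
  · exact Eq.trans (Eq.symm hv) hw
  · exact hv.elim

theorem next_eq (htop : h.InOpenTopCone k) {v : V} {f f' : h.Edge} (hf : F.Into v f)
    (hv : h.marksAt v = ∅) (hf' : F.Out v f') : F.next f = f' := by
  have hex : ∃ f' v, F.Into v f ∧ h.marksAt v = ∅ ∧ F.Out v f' := ⟨f', v, hf, hv, hf'⟩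
  rw [next, dif_pos hex]
  obtain ⟨w, hw, -, hw'⟩ := hex.choose_spec
  have := F.into_unique hf hw
  subst this
  exact (F.existsUnique_out htop hv).unique hw' hf'

theorem next_eq_self {f : h.Edge} (hf : ∀ v, F.Into v f → h.marksAt v ≠ ∅) : F.next f = f := by
  rw [next, dif_neg]
  rintro ⟨f', v, h1, h2, -⟩
  exact hf v h1 h2

/-- The height of the vertex an edge points to; ends point to infinity. -/
def level : h.Edge → ℕ :=
  Sum.elim (fun e => F.height (F.tgt e)) fun _ => Fintype.card h.graph.edgeSet + 1

theorem level_le (f : h.Edge) : F.level f ≤ Fintype.card h.graph.edgeSet + 1 := by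
  rcases f with e | j
  · exact (F.height_le _).trans (Nat.le_succ _)
  · exact le_rfl

theorem height_lt_level {v : V} {f : h.Edge} (hf : F.Out v f) : F.height v < F.level f := by
  rcases f with e | j
  · rcases (F.mem_edge_iff e v).1 hf.1 with hv | hv
    · rw [hv]
      exact F.height_lt e
    · exact absurd hv.symm hf.2
  · exact Nat.lt_succ_of_le (F.height_le v)

theorem level_of_into {v : V} {f : h.Edge} (hf : F.Into v f) : F.level f = F.height v := by
  rcases f with e | j
  · have : F.tgt e = v := hf
    subst this
    rfl
  · exact hf.elim

theorem next_eq_self_or (htop : h.InOpenTopCone k) (f : h.Edge) :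
    F.next f = f ∨ ∃ v, F.Into v f ∧ h.marksAt v = ∅ ∧ F.Out v (F.next f) := by
  by_cases hf : ∀ v, F.Into v f → h.marksAt v ≠ ∅
  · exact Or.inl (F.next_eq_self hf)
  · push Not at hf
    obtain ⟨v, hv, hv'⟩ := hf
    obtain ⟨f', hf', -⟩ := F.existsUnique_out htop hv'
    refine Or.inr ⟨v, hv, hv', ?_⟩
    rwa [F.next_eq htop hv hv' hf']

theorem level_lt_next (htop : h.InOpenTopCone k) {f : h.Edge} (hf : F.next f ≠ f) :
    F.level f < F.level (F.next f) := by
  rcases F.next_eq_self_or htop f with h' | ⟨v, hv, -, hv'⟩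
  · exact absurd h' hf
  · rw [F.level_of_into hv]
    exact F.height_lt_level hv'

theorem component_next (htop : h.InOpenTopCone k) (f : h.Edge) :
    h.component (F.next f) = h.component f := by
  rcases F.next_eq_self_or htop f with h' | ⟨v, hv, hv0, hv'⟩
  · rw [h']
  · by_cases hne : F.next f = f
    · rw [hne]
    · refine SimpleGraph.ConnectedComponent.sound (SimpleGraph.Adj.reachable ?_)
      exact ⟨hne, v, hv0, hv'.1, F.incident_of_into hv⟩

/-- The last edge of the oriented path that starts with a given edge and passes through no marked
vertex. The number of iterations exceeds the length of any such path, along which the level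
increases. -/
def term (f : h.Edge) : h.Edge := F.next^[Fintype.card h.graph.edgeSet + 2] f

theorem iterate_next (htop : h.InOpenTopCone k) (f : h.Edge) (N : ℕ) :
    F.next (F.next^[N] f) = F.next^[N] f ∨ N ≤ F.level (F.next^[N] f) := by
  induction N with
  | zero => exact Or.inr (Nat.zero_le _)
  | succ N ih =>
    rw [Function.iterate_succ_apply']
    by_cases hN : F.next (F.next^[N] f) = F.next^[N] f
    · left; rw [hN, hN]
    · right
      have h1 := ih.resolve_left hN
      have h2 := F.level_lt_next htop hN
      omega

theorem next_term (htop : h.InOpenTopCone k) (f : h.Edge) : F.next (F.term f) = F.term f := by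
  refine (F.iterate_next htop f _).resolve_right fun h' => ?_
  have := F.level_le (F.next^[Fintype.card h.graph.edgeSet + 2] f)
  omega

theorem term_next (htop : h.InOpenTopCone k) (f : h.Edge) : F.term (F.next f) = F.term f := by
  rw [← F.next_term htop f, term, term, ← Function.iterate_succ_apply, Function.iterate_succ_apply']

theorem term_eq_self {f : h.Edge} (hf : F.next f = f) : F.term f = f :=
  Function.iterate_fixed hf _

theorem component_term (htop : h.InOpenTopCone k) (f : h.Edge) :
    h.component (F.term f) = h.component f := by
  have : ∀ N, h.component (F.next^[N] f) = h.component f := by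
    intro N
    induction N with
    | zero => rfl
    | succ N ih => rw [Function.iterate_succ_apply', F.component_next htop, ih]
  exact this _

theorem level_le_term (htop : h.InOpenTopCone k) (f : h.Edge) :
    F.level f ≤ F.level (F.term f) := by
  have : ∀ N, F.level f ≤ F.level (F.next^[N] f) := by
    intro N
    induction N with
    | zero => exact le_rfl
    | succ N ih =>
      rw [Function.iterate_succ_apply']
      by_cases hN : F.next (F.next^[N] f) = F.next^[N] f
      · rwa [hN]
      · exact ih.trans (F.level_lt_next htop hN).le
  exact this _

/-- All edges of a component lead to the same last edge: at a vertex without marked points all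
paths continue along the unique outgoing edge. -/
theorem term_eq_of_component_eq (htop : h.InOpenTopCone k) {f g : h.Edge}
    (hfg : h.component f = h.component g) : F.term f = F.term g := by
  have hadj : ∀ f g, h.complementGraph.Adj f g → F.term f = F.term g := by
    rintro f g ⟨-, v, hv, hf, hg⟩
    obtain ⟨o, ho, huniq⟩ := F.existsUnique_out htop hv
    have key : ∀ f, h.Incident v f → F.term f = F.term o := by
      intro f hf
      by_cases hi : F.Into v f
      · rw [← F.next_eq htop hi hv ho, F.term_next htop]
      · rw [huniq f ⟨hf, hi⟩]
    rw [key f hf, key g hg]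
  obtain ⟨p⟩ := SimpleGraph.ConnectedComponent.exact hfg
  induction p with
  | nil => rfl
  | cons hadj' _ ih =>
    rw [hadj _ _ hadj']
    exact ih (SimpleGraph.ConnectedComponent.sound (SimpleGraph.Walk.reachable ‹_›))

variable (hinj : Function.Injective fun i : Fin r => h.markVertex (Sum.inr i))

theorem next_inEdge (i : Fin r) :
    F.next (Sum.inl (F.inEdge hinj i)) = Sum.inl (F.inEdge hinj i) := by
  refine F.next_eq_self fun v hv hv0 => ?_
  have : F.tgt (F.inEdge hinj i) = v := hv
  rw [tgt_inEdge] at this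
  exact not_marked_of_marksAt hv0 _ this

theorem eq_inEdge_or_end_of_next_eq (htop : h.InOpenTopCone k) {f : h.Edge}
    (hf : F.next f = f) : (∃ i, f = Sum.inl (F.inEdge hinj i)) ∨ ∃ j, f = Sum.inr j := by
  rcases f with e | j
  · left
    by_cases hv : h.marksAt (F.tgt e) = ∅
    · obtain ⟨f', hf', -⟩ := F.existsUnique_out htop hv
      have hi : F.Into (F.tgt e) (Sum.inl e) := rfl
      rw [F.next_eq htop hi hv hf'] at hf
      rw [hf] at hf'
      exact absurd hi hf'.2
    · obtain ⟨m, hm⟩ := Finset.nonempty_iff_ne_empty.2 hv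
      have hm' : h.markVertex m = F.tgt e := by
        simpa [marksAt] using hm
      rcases m with j | i
      · exact absurd hm'.symm (F.tgt_ne_point e j)
      · exact ⟨i, congrArg Sum.inl (F.eq_inEdge hinj hm'.symm)⟩
  · exact Or.inr ⟨j, rfl⟩

/-- The bounded component whose edges lead to the vertex of the `i`-th line constraint. -/
def root (htop : h.InOpenTopCone k) (i : Fin r) : h.BoundedComponent :=
  ⟨h.component (Sum.inl (F.inEdge hinj i)), fun j hj => by
    have h1 := F.term_eq_of_component_eq htop hj
    rw [F.term_eq_self (F.next_inEdge hinj i), F.term_eq_self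
      (F.next_eq_self (f := Sum.inr j) fun _ hv => False.elim hv)] at h1
    cases h1⟩

variable (htop : h.InOpenTopCone k)

theorem inEdge_injective : Function.Injective (F.inEdge hinj) := by
  intro i i' hi
  apply hinj
  have := congrArg F.tgt hi
  rwa [tgt_inEdge, tgt_inEdge] at this

theorem root_bijective : Function.Bijective (F.root hinj htop) := by
  constructor
  · intro i i' hi
    have h1 := F.term_eq_of_component_eq htop (congrArg Subtype.val hi)
    rw [F.term_eq_self (F.next_inEdge hinj i), F.term_eq_self (F.next_inEdge hinj i')] at h1
    exact F.inEdge_injective hinj (Sum.inl.inj h1)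
  · rintro ⟨c, hc⟩
    induction c using SimpleGraph.ConnectedComponent.ind with | _ f =>
    rcases F.eq_inEdge_or_end_of_next_eq hinj htop (F.next_term htop f) with ⟨i, hi⟩ | ⟨j, hj⟩
    · refine ⟨i, Subtype.ext ?_⟩
      change h.component (Sum.inl (F.inEdge hinj i)) = h.component f
      rw [← hi, F.component_term htop]
    · refine absurd ?_ (hc j)
      rw [← hj, F.component_term htop]
      rfl

/-- An edge at the vertex of a line constraint is the incoming edge, or its component leads to a
higher vertex. -/
theorem eq_inEdge_or_height_lt {i i' : Fin r} {f : h.Edge}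
    (hf : h.Incident (h.markVertex (Sum.inr i)) f)
    (hc : h.component f = (F.root hinj htop i').1) :
    f = Sum.inl (F.inEdge hinj i) ∨
      F.height (h.markVertex (Sum.inr i)) < F.height (h.markVertex (Sum.inr i')) := by
  by_cases hi : F.Into (h.markVertex (Sum.inr i)) f
  · left
    rcases f with e | j
    · exact congrArg Sum.inl (F.eq_inEdge hinj hi)
    · exact hi.elim
  · right
    have h1 := F.height_lt_level ⟨hf, hi⟩
    have h2 := F.level_le_term htop f
    have h3 := F.term_eq_of_component_eq htop (g := Sum.inl (F.inEdge hinj i')) hc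
    rw [F.term_eq_self (F.next_inEdge hinj i')] at h3
    rw [h3] at h2
    have h4 : F.level (Sum.inl (F.inEdge hinj i')) = F.height (h.markVertex (Sum.inr i')) :=
      F.level_of_into (F.tgt_inEdge hinj i')
    omega

/-! ### The orientation of the bipartite graph -/

theorem touches_root (i : Fin r) : h.Touches i (F.root hinj htop i) := by
  refine ⟨Sum.inl (F.inEdge hinj i), ?_, rfl⟩
  have := F.tgt_mem (F.inEdge hinj i)
  rw [tgt_inEdge] at this
  exact this

theorem eq_or_height_lt_of_touches {i i' : Fin r}
    (ht : h.Touches i (F.root hinj htop i')) :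
    i = i' ∨ F.height (h.markVertex (Sum.inr i)) < F.height (h.markVertex (Sum.inr i')) := by
  obtain ⟨f, hf, hc⟩ := ht
  rcases F.eq_inEdge_or_height_lt hinj htop hf hc with rfl | hlt
  · exact Or.inl ((F.root_bijective hinj htop).1 (Subtype.ext hc))
  · exact Or.inr hlt

/-- The orientation of `B(Γ)` induced by the orientation of the edges of `Γ`. -/
def orientation : h.BoundedComponent ⊕ Fin r → h.BoundedComponent ⊕ Fin r → Prop
  | Sum.inl c, Sum.inr i => c = F.root hinj htop i
  | Sum.inr i, Sum.inl c => h.Touches i c ∧ c ≠ F.root hinj htop i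
  | _, _ => False

theorem bipartiteGraph_adj_inl_inr (c : h.BoundedComponent) (i : Fin r) :
    h.bipartiteGraph.Adj (Sum.inl c) (Sum.inr i) ↔ h.Touches i c := by
  constructor
  · rintro ⟨c', i', ht, ⟨h1, h2⟩ | ⟨h1, h2⟩⟩
    · cases h1; cases h2; exact ht
    · cases h1
  · exact fun ht => ⟨c, i, ht, Or.inl ⟨rfl, rfl⟩⟩

theorem not_bipartiteGraph_adj_inl (c c' : h.BoundedComponent) :
    ¬ h.bipartiteGraph.Adj (Sum.inl c) (Sum.inl c') := by
  rintro ⟨_, _, -, ⟨h1, h2⟩ | ⟨h1, h2⟩⟩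
  · cases h2
  · cases h1

theorem not_bipartiteGraph_adj_inr (i i' : Fin r) :
    ¬ h.bipartiteGraph.Adj (Sum.inr i) (Sum.inr i') := by
  rintro ⟨_, _, -, ⟨h1, h2⟩ | ⟨h1, h2⟩⟩
  · cases h1
  · cases h2

theorem isAdmissibleOrientation_orientation :
    h.IsAdmissibleOrientation (F.orientation hinj htop) where
  adj_iff := by
    have key : ∀ c i, h.Touches i c ↔ c = F.root hinj htop i ∨
        (h.Touches i c ∧ c ≠ F.root hinj htop i) := by
      intro c i
      have := F.touches_root hinj htop i
      by_cases hc : c = F.root hinj htop i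
      · subst hc; simp [this]
      · simp [hc]
    rintro (c | i) (c' | i')
    · simp [not_bipartiteGraph_adj_inl, orientation]
    · rw [bipartiteGraph_adj_inl_inr]; exact key c i'
    · rw [SimpleGraph.adj_comm, bipartiteGraph_adj_inl_inr, or_comm]; exact key c' i
    · simp [not_bipartiteGraph_adj_inr, orientation]
  asymm := by
    rintro (c | i) (c' | i') h1 h2
    · exact h1
    · exact h2.2 h1
    · exact h1.2 h2
    · exact h1
  white := by
    intro c
    obtain ⟨i, rfl⟩ := (F.root_bijective hinj htop).2 c
    refine ⟨Sum.inr i, rfl, ?_⟩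
    rintro (c' | i') h'
    · exact h'.elim
    · exact congrArg Sum.inr ((F.root_bijective hinj htop).1 h').symm
  black := by
    intro i
    refine ⟨Sum.inl (F.root hinj htop i), rfl, ?_⟩
    rintro (c' | i') h'
    · exact congrArg Sum.inl h'
    · exact h'.elim

/-- In an admissible orientation the inward edge at a line constraint comes from the component that
leads to it. Otherwise the white vertices would be matched with line constraints whose heights have
a smaller sum. -/
theorem orientation_root
    {o : h.BoundedComponent ⊕ Fin r → h.BoundedComponent ⊕ Fin r → Prop}
    (ho : h.IsAdmissibleOrientation o) (i : Fin r) :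
    o (Sum.inl (F.root hinj htop i)) (Sum.inr i) := by
  have hex : ∀ i, ∃ i', o (Sum.inl (F.root hinj htop i')) (Sum.inr i) := by
    intro i
    obtain ⟨x, hx, -⟩ := ho.black i
    rcases x with c | i'
    · obtain ⟨i', rfl⟩ := (F.root_bijective hinj htop).2 c
      exact ⟨i', hx⟩
    · exact absurd ((ho.adj_iff _ _).2 (Or.inl hx)) (not_bipartiteGraph_adj_inr _ _)
  choose π hπ using hex
  have hπinj : Function.Injective π := by
    intro i i' hii
    have h1 := hπ i
    rw [hii] at h1
    exact Sum.inr.inj ((ho.white _).unique h1 (hπ i'))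
  have hle : ∀ i, i = π i ∨
      F.height (h.markVertex (Sum.inr i)) < F.height (h.markVertex (Sum.inr (π i))) := fun i =>
    F.eq_or_height_lt_of_touches hinj htop
      ((bipartiteGraph_adj_inl_inr _ _).1 ((ho.adj_iff _ _).2 (Or.inl (hπ i))))
  have hsum := Equiv.sum_comp (Equiv.ofBijective π (Finite.injective_iff_bijective.1 hπinj))
    fun i => F.height (h.markVertex (Sum.inr i))
  simp only [Equiv.ofBijective_apply] at hsum
  have heq := (Finset.sum_eq_sum_iff_of_le (fun i _ => by
    rcases hle i with h' | h'
    · rw [← h']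
    · exact h'.le)).1 hsum.symm i (Finset.mem_univ i)
  have hi : i = π i := (hle i).resolve_right fun h' => h'.ne heq
  have := hπ i
  rwa [← hi] at this

theorem orientation_unique
    {o : h.BoundedComponent ⊕ Fin r → h.BoundedComponent ⊕ Fin r → Prop}
    (ho : h.IsAdmissibleOrientation o) : o = F.orientation hinj htop := by
  have hr := F.orientation_root hinj htop ho
  have hwb : ∀ c i, o (Sum.inl c) (Sum.inr i) ↔ c = F.root hinj htop i := by
    intro c i
    constructor
    · intro h'
      exact Sum.inl.inj ((ho.black i).unique h' (hr i))
    · rintro rfl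
      exact hr i
  funext x y
  apply propext
  rcases x with c | i <;> rcases y with c' | i'
  · exact ⟨fun h' => not_bipartiteGraph_adj_inl _ _ ((ho.adj_iff _ _).2 (Or.inl h')), False.elim⟩
  · exact hwb c i'
  · have h1 := ho.adj_iff (Sum.inl c') (Sum.inr i)
    rw [bipartiteGraph_adj_inl_inr, hwb] at h1
    have h2 := ho.asymm (Sum.inr i) (Sum.inl c')
    rw [hwb] at h2
    exact ⟨fun h' => ⟨h1.2 (Or.inr h'), h2 h'⟩, fun h' => (h1.1 h'.1).resolve_left h'.2⟩
  · exact ⟨fun h' => not_bipartiteGraph_adj_inr _ _ ((ho.adj_iff _ _).2 (Or.inl h')), False.elim⟩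

/-- The edge that carries the inward edge of an admissible orientation at a line constraint is the
incoming edge. -/
theorem dartEdge_eq_inEdge (htop : h.InOpenTopCone k)
    {o : h.BoundedComponent ⊕ Fin r → h.BoundedComponent ⊕ Fin r → Prop}
    (ho : h.IsAdmissibleOrientation o) {i : Fin r} {a : h.graph.Dart}
    (ha : a.fst = h.markVertex (Sum.inr i)) {c : h.BoundedComponent}
    (hc : o (Sum.inl c) (Sum.inr i)) (hac : h.component (Sum.inl (h.dartEdge a)) = c.1) :
    h.dartEdge a = F.inEdge hinj i := by
  rw [F.orientation_unique hinj htop ho] at hc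
  have hc' : c = F.root hinj htop i := hc
  subst hc'
  have hinc : h.Incident (h.markVertex (Sum.inr i)) (Sum.inl (h.dartEdge a)) := by
    change _ ∈ s(a.fst, a.snd)
    rw [Sym2.mem_iff]; exact Or.inl ha.symm
  exact Sum.inl.inj ((F.eq_inEdge_or_height_lt hinj htop hinc hac).resolve_right
    fun h' => lt_irrefl _ h')

end Flow

end ParamCurve

/-! ### The multiplicity as an index -/

theorem det_eq_zero_of_det_eq_zero {a b c : ℤ × ℤ} (ha : a ≠ 0) (hab : det a b = 0)
    (hac : det a c = 0) : det b c = 0 := by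
  unfold det at *
  by_cases h1 : a.1 = 0
  · have h2 : a.2 ≠ 0 := fun h2 => ha (Prod.ext h1 h2)
    have : a.2 * (b.1 * c.2 - b.2 * c.1) = 0 := by linear_combination b.2 * hac - c.2 * hab
    exact (mul_eq_zero.1 this).resolve_left h2
  · have : a.1 * (b.1 * c.2 - b.2 * c.1) = 0 := by linear_combination b.1 * hac - c.1 * hab
    exact (mul_eq_zero.1 this).resolve_left h1

/-- If a triangular system has no nonzero solution, its diagonal blocks are nondegenerate: a
degenerate block leaves fewer independent equations than unknowns among the functions supported
at its height or above. -/
theorem det_ne_zero_of_triangular {V Q : Type} [Fintype V] {σ : V × Fin 2 ≃ Q} {s : Q → ℤ × ℤ}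
    {p : Q → (V → ℤ × ℤ) →+ ℤ × ℤ} {ht : V → ℕ}
    (hp : ∀ w b x, (∀ v, ht v < ht w → x v = 0) → p (σ (w, b)) x = 0) (hs : ∀ q, s q ≠ 0)
    (hrigid : ∀ x, (∀ w b, det (s (σ (w, b))) (x w - p (σ (w, b)) x) = 0) → x = 0) (w : V) :
    det (s (σ (w, 0))) (s (σ (w, 1))) ≠ 0 := by
  classical
  intro h0
  let S := {v : V // ht w ≤ ht v}
  let w' : S := ⟨w, le_rfl⟩
  let extend : (S → ℤ × ℤ) →+ (V → ℤ × ℤ) :=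
    { toFun := fun x v => if hv : ht w ≤ ht v then x ⟨v, hv⟩ else 0
      map_zero' := by funext v; simp
      map_add' := by
        intro x y; funext v
        by_cases hv : ht w ≤ ht v <;> simp [hv] }
  have hlow : ∀ x v, ht v < ht w → extend x v = 0 := fun x v hv => dif_neg (by omega)
  -- the equations at the vertices of `S`, without the second one at `w`, which the first
  -- implies because the block at `w` is degenerate
  let Ψ : (S → ℤ × ℤ) →+ ({q : S × Fin 2 // q ≠ (w', 1)} → ℤ) :=
    { toFun := fun x q => det (s (σ (q.1.1, q.1.2)))
        (extend x q.1.1 - p (σ (q.1.1, q.1.2)) (extend x))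
      map_zero' := by funext q; simp [det]
      map_add' := by
        intro x y; funext q
        simp only [map_add, Pi.add_apply, ← ParamCurve.det_add]
        congr 1; abel }
  have hcard : Fintype.card {q : S × Fin 2 // q ≠ (w', 1)} + 1 = 2 * Fintype.card S := by
    have : Fintype.card {q : S × Fin 2 // q ≠ (w', 1)} = Fintype.card (S × Fin 2) - 1 := by
      rw [Fintype.card_subtype_compl, Fintype.card_subtype_eq]
    have hpos : 0 < Fintype.card S := Fintype.card_pos_iff.2 ⟨w'⟩
    rw [this, Fintype.card_prod, Fintype.card_fin]
    omega
  have hker : LinearMap.ker Ψ.toIntLinearMap ≠ ⊥ := by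
    intro hbot
    have hle := LinearMap.finrank_le_finrank_of_injective (LinearMap.ker_eq_bot.1 hbot)
    rw [Module.finrank_fintype_fun_eq_card, Module.finrank_pi_fintype] at hle
    simp only [Module.finrank_prod, Module.finrank_self, Finset.sum_const, Finset.card_univ,
      smul_eq_mul] at hle
    omega
  obtain ⟨x, hx, hx0⟩ := Submodule.exists_mem_ne_zero_of_ne_bot hker
  have hΨ : Ψ x = 0 := hx
  have hX : extend x = 0 := by
    refine hrigid _ fun v b => ?_
    by_cases hv : ht w ≤ ht v
    · by_cases hvb : ((⟨v, hv⟩ : S), b) = (w', 1)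
      · have h1 : v = w := congrArg (fun z : S × Fin 2 => z.1.1) hvb
        have h2 : b = 1 := congrArg Prod.snd hvb
        subst h1; subst h2
        have h3 : det (s (σ (v, 0))) (extend x v - p (σ (v, 0)) (extend x)) = 0 :=
          congrFun hΨ ⟨(w', 0), by simp⟩
        rw [hp v 0 _ (hlow x)] at h3
        rw [hp v 1 _ (hlow x)]
        exact det_eq_zero_of_det_eq_zero (hs _) h0 h3
      · exact congrFun hΨ ⟨(⟨v, hv⟩, b), hvb⟩
    · have hv' : ht v < ht w := by omega
      rw [hlow x v hv', hp v b _ fun u hu => hlow x u (by omega), sub_zero, ParamCurve.det_zero]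
  apply hx0
  funext v
  have := congrFun hX v.1
  simpa [extend, v.2] using this

theorem openRay_unique {p x : ℝ × ℝ} {s s' : Fin 3} (h : x ∈ openRay p s) (h' : x ∈ openRay p s') :
    s = s' := by
  obtain ⟨t, ht, rfl⟩ := h
  obtain ⟨t', ht', h'⟩ := h'
  have h1 := congrArg Prod.fst h'
  have h2 := congrArg Prod.snd h'
  fin_cases s <;> fin_cases s' <;> simp [dir, toReal] at h1 h2 ⊢ <;> linarith

namespace ParamCurve

variable {n r d : ℕ} {V : Type} [Fintype V] {h : ParamCurve n r d V} {k : Fin r → ℕ}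

namespace Flow

variable (F : h.Flow)

/-- The direction in which a condition leaves its vertex free. The two conditions of a point
constraint fix one coordinate each. -/
def direction (s : Fin r → Fin 3) : h.Condition → ℤ × ℤ :=
  Sum.elim (fun e => h.slope (F.dart e)) (Sum.elim (fun i => dir (s i))
    fun j => ![(1, 0), (0, 1)] j.2)

/-- The position of the vertex from which an edge comes; zero for the constraints. -/
def source : h.Condition → (V → ℤ × ℤ) →+ ℤ × ℤ :=
  Sum.elim (fun e => Pi.evalAddMonoidHom _ (F.dart e).fst) fun _ => 0

theorem source_eq_zero (w : V) (b : Fin 2) (x : V → ℤ × ℤ)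
    (hx : ∀ v, F.height v < F.height w → x v = 0) : F.source (F.slots (w, b)) x = 0 := by
  rcases hq : F.slots (w, b) with e | q
  · have := F.tgt_eq_of_slots hq
    subst this
    exact hx _ (F.height_lt e)
  · rfl

theorem direction_ne_zero {ρ : V} {s : Fin r → Fin 3}
    (hli : LinearIndependent ℝ fun j m => toReal (h.tangent ρ s j m)) (q : h.Condition) :
    F.direction s q ≠ 0 := by
  rcases q with e | i | ⟨j, b⟩
  · exact h.slope_ne_zero hli _
  · exact dir_ne_zero _
  · fin_cases b <;> simp [direction]

/-- What holds at both places of every vertex holds for every condition at its vertex. -/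
theorem forall_slots {P : h.Condition → V → Prop} (hP : ∀ w b, P (F.slots (w, b)) w)
    (q : h.Condition) : P q (F.slots.symm q).1 := by
  have := hP (F.slots.symm q).1 (F.slots.symm q).2
  rwa [Prod.mk.eta, Equiv.apply_symm_apply] at this

theorem det_direction_ne_zero {ρ : V} {s : Fin r → Fin 3}
    (hli : LinearIndependent ℝ fun j m => toReal (h.tangent ρ s j m)) (w : V) :
    det (F.direction s (F.slots (w, 0))) (F.direction s (F.slots (w, 1))) ≠ 0 := by
  refine det_ne_zero_of_triangular (p := F.source) F.source_eq_zero (F.direction_ne_zero hli) ?_ w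
  intro x hx
  have hq := F.forall_slots (P := fun q v => det (F.direction s q) (x v - F.source q x) = 0) hx
  refine h.eq_zero_of_det_eq_zero hli ?_ ?_ ?_
  · have h1 : ∀ e, det (h.slope (F.dart e)) (x (F.dart e).snd - x (F.dart e).fst) = 0 := by
      intro e
      rw [dart_snd]
      exact hq (Sum.inl e)
    intro a
    rcases F.eq_dart_or_eq_symm a with ha | ha
    · rw [ha]; exact h1 _
    · rw [ha, slope_symm, ← h1 (h.dartEdge a)]
      simp [det]
      ring
  · intro i
    have := hq (Sum.inr (Sum.inl i))
    rw [slots_symm_line] at this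
    simpa [source, direction] using this
  · intro j
    have h0 := hq (Sum.inr (Sum.inr (j, 0)))
    have h1 := hq (Sum.inr (Sum.inr (j, 1)))
    rw [slots_symm_point] at h0 h1
    simp [direction, source, det] at h0 h1
    exact Prod.ext h1 h0

/-- The constraints as components of a vector indexed by the conditions. -/
def toConditions (h : ParamCurve n r d V) : (Mark n r → ℤ × ℤ) →+ (h.Condition → ℤ × ℤ) where
  toFun g := Sum.elim (fun _ => 0) (Sum.elim (fun i => g (Sum.inr i)) fun j => g (Sum.inl j.1))
  map_zero' := by funext q; rcases q with e | i | j <;> rfl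
  map_add' g g' := by funext q; rcases q with e | i | j <;> simp

/-- The vectors `y` for which the equations of all conditions have a common solution. -/
def solvable (s : Fin r → Fin 3) : AddSubgroup (h.Condition → ℤ × ℤ) :=
  (triangularPairs F.slots (F.direction s) F.source Finset.univ).map (AddMonoidHom.fst _ _)

theorem mem_solvable_iff {s : Fin r → Fin 3} {y : h.Condition → ℤ × ℤ} :
    y ∈ F.solvable s ↔ ∃ x : V → ℤ × ℤ,
      (∀ e, ∃ c : ℤ, y (Sum.inl e) = x (F.dart e).snd - x (F.dart e).fst +
        c • h.slope (F.dart e)) ∧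
      (∀ i, ∃ c : ℤ, y (Sum.inr (Sum.inl i)) = x (h.markVertex (Sum.inr i)) + c • dir (s i)) ∧
      ∀ j, (y (Sum.inr (Sum.inr (j, 0)))).2 = (x (h.markVertex (Sum.inl j))).2 ∧
        (y (Sum.inr (Sum.inr (j, 1)))).1 = (x (h.markVertex (Sum.inl j))).1 := by
  constructor
  · rintro ⟨⟨y, x⟩, ⟨-, hyx⟩, rfl⟩
    have hq := F.forall_slots (P := fun q v => ∃ c : ℤ, y q = x v - F.source q x +
      c • F.direction s q) fun w b => hyx w (Finset.mem_univ w) b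
    refine ⟨x, fun e => ?_, fun i => ?_, fun j => ?_⟩
    · rw [dart_snd]
      exact hq (Sum.inl e)
    · have := hq (Sum.inr (Sum.inl i))
      rw [slots_symm_line] at this
      obtain ⟨c, hc⟩ := this
      exact ⟨c, hc.trans (by simp [source, direction])⟩
    · have h0 := hq (Sum.inr (Sum.inr (j, 0)))
      have h1 := hq (Sum.inr (Sum.inr (j, 1)))
      rw [slots_symm_point] at h0 h1
      obtain ⟨c0, hc0⟩ := h0
      obtain ⟨c1, hc1⟩ := h1
      constructor
      · change (y _).2 = _
        rw [hc0]; simp [source, direction]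
      · change (y _).1 = _
        rw [hc1]; simp [source, direction]
  · rintro ⟨x, he, hi, hj⟩
    refine ⟨(y, x), ⟨fun v hv => absurd (Finset.mem_univ v) hv, fun w _ b => ?_⟩, rfl⟩
    have hon := F.onVertex w b
    simp only
    rcases hq : F.slots (w, b) with e | i | ⟨j, b'⟩
    · have := F.tgt_eq_of_slots hq
      subst this
      rw [← dart_snd]
      exact he e
    · rw [hq] at hon
      have hw : h.markVertex (Sum.inr i) = w := hon
      subst hw
      obtain ⟨c, hc⟩ := hi i
      exact ⟨c, hc.trans (by simp [source, direction])⟩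
    · rw [hq] at hon
      have hw : h.markVertex (Sum.inl j) = w := hon
      subst hw
      have hjj := hj j
      fin_cases b'
      · refine ⟨(y (Sum.inr (Sum.inr (j, 0)))).1 - (x (h.markVertex (Sum.inl j))).1, ?_⟩
        refine Prod.ext ?_ ?_
        · simp [source, direction]
        · simpa [source, direction] using hjj.1
      · refine ⟨(y (Sum.inr (Sum.inr (j, 1)))).2 - (x (h.markVertex (Sum.inl j))).2, ?_⟩
        refine Prod.ext ?_ ?_
        · simpa [source, direction] using hjj.2
        · simp [source, direction]

theorem index_solvable {ρ : V} {s : Fin r → Fin 3}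
    (hli : LinearIndependent ℝ fun j m => toReal (h.tangent ρ s j m)) :
    (F.solvable s).index =
      ∏ w, (det (F.direction s (F.slots (w, 0))) (F.direction s (F.slots (w, 1)))).natAbs :=
  index_triangular F.source_eq_zero (F.det_direction_ne_zero hli)

/-- Modulo solvable vectors, every vector comes from the marked points, since the positions of the
vertices of a tree can be chosen with arbitrary differences along the edges. -/
theorem solvable_sup_range (s : Fin r → Fin 3) : F.solvable s ⊔ (toConditions h).range = ⊤ := by
  rw [eq_top_iff]
  intro y _
  classical
  obtain ⟨ρ⟩ := h.isTree.connected.nonempty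
  let z : h.graph.Dart → ℤ × ℤ := fun a =>
    if a = F.dart (h.dartEdge a) then y (Sum.inl (h.dartEdge a)) else - y (Sum.inl (h.dartEdge a))
  have hz : ∀ a, z a.symm = - z a := by
    intro a
    have he : h.dartEdge a.symm = h.dartEdge a := h.dartEdge_eq_iff.2 (Or.inr rfl)
    simp only [z, he]
    rcases F.eq_dart_or_eq_symm a with ha | ha
    · have : a.symm ≠ F.dart (h.dartEdge a) := by
        rw [← ha]; exact SimpleGraph.Dart.symm_ne a
      rw [if_neg this, if_pos ha]
    · have h1 : a.symm = F.dart (h.dartEdge a) := by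
        conv_lhs => rw [ha]
        exact SimpleGraph.Dart.symm_symm _
      have h2 : a ≠ F.dart (h.dartEdge a) := by
        rw [← h1]; exact (SimpleGraph.Dart.symm_ne a).symm
      rw [if_pos h1, if_neg h2, neg_neg]
  let x := potential ρ z
  have hx : ∀ e, x (F.dart e).snd - x (F.dart e).fst = y (Sum.inl e) := by
    intro e
    rw [potential_snd_sub_fst h.isTree ρ z hz]
    simp [z]
  let g : Mark n r → ℤ × ℤ := Sum.elim
    (fun j => ((y (Sum.inr (Sum.inr (j, 1)))).1 - (x (h.markVertex (Sum.inl j))).1,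
      (y (Sum.inr (Sum.inr (j, 0)))).2 - (x (h.markVertex (Sum.inl j))).2))
    (fun i => y (Sum.inr (Sum.inl i)) - x (h.markVertex (Sum.inr i)))
  have hy : y = (y - toConditions h g) + toConditions h g := by abel
  rw [hy]
  refine AddSubgroup.add_mem_sup (F.mem_solvable_iff.2 ⟨x, fun e => ⟨0, ?_⟩, fun i => ⟨0, ?_⟩,
    fun j => ⟨?_, ?_⟩⟩) ⟨g, rfl⟩
  · rw [hx]; simp [toConditions]
  · simp [toConditions, g]
  · simp [toConditions, g]
  · simp [toConditions, g]

theorem lineLattice_eq {p x : ℝ × ℝ} {s : Fin 3} (hx : x ∈ openRay p s) :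
    lineLattice p x = AddSubgroup.zmultiples (dir s) := by
  rw [lineLattice, AddSubgroup.zmultiples_eq_closure]
  congr 1
  ext a
  constructor
  · rintro ⟨s', hs', rfl⟩
    rw [openRay_unique hs' hx]
    rfl
  · intro ha
    exact ⟨s, hx, ha⟩

theorem map_evalHom_sup_eq_comap {ξ : Mark n r → ℝ × ℝ} {s : Fin r → Fin 3}
    (hs : ∀ i, h.pos (h.markVertex (Sum.inr i)) ∈ openRay (ξ (Sum.inr i)) (s i)) :
    h.coneLattice.map h.evalHom ⊔ h.constraintLattice ξ =
      (F.solvable s).comap (toConditions h) := by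
  ext g
  rw [AddSubgroup.mem_sup, AddSubgroup.mem_comap, mem_solvable_iff]
  constructor
  · rintro ⟨_, ⟨⟨x, ℓ⟩, hx, rfl⟩, t, ht, rfl⟩
    rw [constraintLattice, AddSubgroup.mem_pi] at ht
    refine ⟨x, fun e => ⟨- ℓ e, ?_⟩, fun i => ?_, fun j => ?_⟩
    · have := hx (F.dart e)
      simp only [dartEdge_dart] at this
      rw [this]
      simp [toConditions]
    · have h1 := ht (Sum.inr i) (Set.mem_univ _)
      simp only [Sum.elim_inr] at h1
      rw [lineLattice_eq (hs i)] at h1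
      obtain ⟨c, hc⟩ := AddSubgroup.mem_zmultiples_iff.1 h1
      refine ⟨c, ?_⟩
      rw [hc]; rfl
    · have h1 := ht (Sum.inl j) (Set.mem_univ _)
      simp only [Sum.elim_inl, AddSubgroup.mem_bot] at h1
      simp [toConditions, h1, evalHom]
  · rintro ⟨x, he, hi, hj⟩
    choose c hc using he
    choose t ht using hi
    have hcone : (x, fun e => - c e) ∈ h.coneLattice := by
      intro a
      have h1 := hc (h.dartEdge a)
      have h2 : x (F.dart (h.dartEdge a)).snd - x (F.dart (h.dartEdge a)).fst =
          - c (h.dartEdge a) • h.slope (F.dart (h.dartEdge a)) := by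
        rw [neg_smul]
        exact eq_neg_of_add_eq_zero_left h1.symm
      rcases F.eq_dart_or_eq_symm a with ha | ha
      · rw [← ha] at h2; exact h2
      · have h3 : F.dart (h.dartEdge a) = a.symm := by
          conv_rhs => rw [ha]
          exact (SimpleGraph.Dart.symm_symm _).symm
        rw [h3, slope_symm, smul_neg] at h2
        simp only [SimpleGraph.Dart.symm_toProd, Prod.fst_swap, Prod.snd_swap] at h2
        simp only
        rw [← neg_sub, h2, neg_neg]
    refine ⟨_, ⟨_, hcone, rfl⟩, Sum.elim (fun _ => 0) fun i => t i • dir (s i), ?_, ?_⟩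
    · rw [constraintLattice, AddSubgroup.mem_pi]
      rintro (j | i) -
      · exact AddSubgroup.mem_bot.2 rfl
      · simp only [Sum.elim_inr]
        rw [lineLattice_eq (hs i)]
        exact AddSubgroup.mem_zmultiples_iff.2 ⟨t i, rfl⟩
    · funext m
      rcases m with j | i
      · have := hj j
        simp [toConditions] at this
        simp [evalHom]
        exact Prod.ext this.2.symm this.1.symm
      · exact (ht i).symm

theorem index_eq_prod {ρ : V} {ξ : Mark n r → ℝ × ℝ} {s : Fin r → Fin 3}
    (hli : LinearIndependent ℝ fun j m => toReal (h.tangent ρ s j m))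
    (hs : ∀ i, h.pos (h.markVertex (Sum.inr i)) ∈ openRay (ξ (Sum.inr i)) (s i)) :
    (h.coneLattice.map h.evalHom ⊔ h.constraintLattice ξ).index =
      ∏ w, (det (F.direction s (F.slots (w, 0))) (F.direction s (F.slots (w, 1)))).natAbs := by
  rw [F.map_evalHom_sup_eq_comap hs, AddSubgroup.index_comap,
    ← AddSubgroup.relIndex_sup_left, F.solvable_sup_range, AddSubgroup.relIndex_top_right,
    F.index_solvable hli]

/-! ### The factors of the multiplicity -/

theorem natAbs_det_comm (a b : ℤ × ℤ) : (det a b).natAbs = (det b a).natAbs := by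
  rw [← Int.natAbs_neg]; congr 1; simp [det]; ring

theorem natAbs_det_neg_left (a b : ℤ × ℤ) : (det (-a) b).natAbs = (det a b).natAbs := by
  rw [← Int.natAbs_neg]; congr 1; simp [det]; ring

theorem natAbs_det_neg_right (a b : ℤ × ℤ) : (det a (-b)).natAbs = (det a b).natAbs := by
  rw [natAbs_det_comm, natAbs_det_neg_left, natAbs_det_comm]

/-- The determinant of two of three vectors with sum zero does not depend on the choice, up to
sign. -/
theorem natAbs_det_eq_of_sum_eq_zero {α : Type*} [Fintype α] (hα : Fintype.card α = 3)
    (g : α → ℤ × ℤ) (hg : ∑ x, g x = 0) {a b a' b' : α} (hab : a ≠ b) (hab' : a' ≠ b') :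
    (det (g a) (g b)).natAbs = (det (g a') (g b')).natAbs := by
  classical
  obtain ⟨c, hca, hcb, hc⟩ := exists_third hα hab
  have huniv : (Finset.univ : Finset α) = {a, b, c} := by
    ext x; simpa using hc x
  rw [huniv, Finset.sum_insert (by simp [hab, hca.symm]), Finset.sum_pair hcb.symm] at hg
  have hgc : g c = - g a - g b := by
    rw [← add_assoc] at hg
    rw [eq_neg_of_add_eq_zero_right hg]; abel
  have h1 : (det (g a) (g c)).natAbs = (det (g a) (g b)).natAbs := by
    rw [hgc, ← Int.natAbs_neg]; congr 1; simp [det]; ring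
  have h2 : (det (g b) (g c)).natAbs = (det (g a) (g b)).natAbs := by
    rw [hgc]; congr 1; simp [det]; ring
  rcases hc a' with rfl | rfl | rfl <;> rcases hc b' with rfl | rfl | rfl
  all_goals first
    | exact absurd rfl hab'
    | rfl
    | exact h1.symm
    | exact h2.symm
    | exact natAbs_det_comm _ _
    | (rw [natAbs_det_comm (g a')]; exact h1.symm)
    | (rw [natAbs_det_comm (g a')]; exact h2.symm)

theorem natAbs_det_unmarked (htop : h.InOpenTopCone k) (s : Fin r → Fin 3) {v : V}
    (hv : h.marksAt v = ∅) {a b : h.Flag v} (hab : a ≠ b) :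
    (det (F.direction s (F.slots (v, 0))) (F.direction s (F.slots (v, 1)))).natAbs =
      (det (h.flagSlope h.slope v a) (h.flagSlope h.slope v b)).natAbs := by
  obtain ⟨e0, h0⟩ := F.exists_slots_unmarked hv 0
  obtain ⟨e1, h1⟩ := F.exists_slots_unmarked hv 1
  have t0 := F.tgt_eq_of_slots h0
  have t1 := F.tgt_eq_of_slots h1
  have hne : e0 ≠ e1 := by
    rintro rfl
    have := congrArg Prod.snd (F.slots.injective (h0.trans h1.symm))
    simp at this
  let x0 : h.Flag v := Sum.inl ⟨(F.dart e0).symm, by simp [t0]⟩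
  let x1 : h.Flag v := Sum.inl ⟨(F.dart e1).symm, by simp [t1]⟩
  have hx : x0 ≠ x1 := by
    intro h'
    have h2 := congrArg (fun a => h.dartEdge a.symm) (congrArg Subtype.val (Sum.inl.inj h'))
    simp only [SimpleGraph.Dart.symm_symm, dartEdge_dart] at h2
    exact hne h2
  rw [natAbs_det_eq_of_sum_eq_zero (valency_of_marksAt htop hv) (h.flagSlope h.slope v)
    (h.balanced v) hab hx, h0, h1]
  change (det (h.slope (F.dart e0)) (h.slope (F.dart e1))).natAbs =
    (det (h.slope (F.dart e0).symm) (h.slope (F.dart e1).symm)).natAbs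
  rw [slope_symm, slope_symm, natAbs_det_neg_left, natAbs_det_neg_right]

theorem natAbs_det_line (hinj : Function.Injective fun i : Fin r => h.markVertex (Sum.inr i))
    (s : Fin r → Fin 3) (i : Fin r) :
    (det (F.direction s (F.slots (h.markVertex (Sum.inr i), 0)))
      (F.direction s (F.slots (h.markVertex (Sum.inr i), 1)))).natAbs =
      (det (dir (s i)) (h.slope (F.dart (F.inEdge hinj i)))).natAbs := by
  obtain ⟨b, b', hb, hq, hq'⟩ := (F.exists_slots_line hinj i).choose_spec
  have hb2 : (b = 0 ∧ b' = 1) ∨ (b = 1 ∧ b' = 0) := by omega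
  rcases hb2 with ⟨rfl, rfl⟩ | ⟨rfl, rfl⟩
  · rw [hq, hq', natAbs_det_comm]; rfl
  · rw [hq, hq']; rfl

theorem natAbs_det_point (s : Fin r → Fin 3) (j : Fin n) :
    (det (F.direction s (F.slots (h.markVertex (Sum.inl j), 0)))
      (F.direction s (F.slots (h.markVertex (Sum.inl j), 1)))).natAbs = 1 := by
  obtain ⟨b, hb⟩ := F.slots_point j (F.slots (h.markVertex (Sum.inl j), 0)) (by simp)
  obtain ⟨b', hb'⟩ := F.slots_point j (F.slots (h.markVertex (Sum.inl j), 1)) (by simp)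
  have hne : b ≠ b' := by
    rintro rfl
    have := congrArg Prod.snd (F.slots.injective (hb.trans hb'.symm))
    simp at this
  rw [hb, hb']
  fin_cases b <;> fin_cases b' <;> simp [direction, det] at hne ⊢

theorem prod_natAbs_det (htop : h.InOpenTopCone k)
    (hinj : Function.Injective fun i : Fin r => h.markVertex (Sum.inr i)) (s : Fin r → Fin 3)
    (a b : ∀ v : V, h.Flag v) (hab : ∀ v, a v ≠ b v) :
    ∏ w, (det (F.direction s (F.slots (w, 0))) (F.direction s (F.slots (w, 1)))).natAbs =
      (∏ i, (det (dir (s i)) (h.slope (F.dart (F.inEdge hinj i)))).natAbs) *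
        ∏ v ∈ h.unmarked,
          (det (h.flagSlope h.slope v (a v)) (h.flagSlope h.slope v (b v))).natAbs := by
  classical
  have hun : h.unmarked = Finset.univ.filter fun v => h.marksAt v = ∅ := by
    ext v; simp [unmarked]
  rw [← Finset.prod_filter_mul_prod_filter_not Finset.univ (fun v => h.marksAt v = ∅), mul_comm,
    hun]
  congr 1
  · rw [← Finset.prod_congr rfl fun i _ => F.natAbs_det_line hinj s i,
      ← Finset.prod_image (g := fun i : Fin r => h.markVertex (Sum.inr i))
        (f := fun w => (det (F.direction s (F.slots (w, 0)))
          (F.direction s (F.slots (w, 1)))).natAbs) (fun _ _ _ _ hii => hinj hii)]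
    symm
    refine Finset.prod_subset ?_ ?_
    · intro w hw
      obtain ⟨i, -, rfl⟩ := Finset.mem_image.1 hw
      rw [Finset.mem_filter]
      exact ⟨Finset.mem_univ _, fun h0 => not_marked_of_marksAt h0 _ rfl⟩
    · intro w hw hw'
      rw [Finset.mem_filter] at hw
      obtain ⟨m, hm⟩ := Finset.nonempty_iff_ne_empty.2 hw.2
      have hm' : h.markVertex m = w := by simpa [marksAt] using hm
      subst hm'
      rcases m with j | i
      · exact F.natAbs_det_point s j
      · exact absurd (Finset.mem_image.2 ⟨i, Finset.mem_univ i, rfl⟩) hw'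
  · refine Finset.prod_congr rfl fun v hv => ?_
    rw [Finset.mem_filter] at hv
    exact F.natAbs_det_unmarked htop s hv.2 (hab v)

end Flow

/-- If the line constraints are at distinct vertices, the weight of the cone is one. -/
theorem prod_multinomial (hinj : Function.Injective fun i : Fin r => h.markVertex (Sum.inr i)) :
    ∏ v, Nat.multinomial (h.marksAt v) (psiExponent k) = 1 := by
  classical
  refine Finset.prod_eq_one fun v _ => ?_
  have key : ∀ m ∈ h.marksAt v, (∀ m' ∈ h.marksAt v, m' ≠ m → psiExponent k m' = 0) →
      Nat.multinomial (h.marksAt v) (psiExponent k) = 1 := by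
    intro m hm h0
    rw [Nat.multinomial, Finset.sum_eq_single_of_mem m hm h0,
      Finset.prod_eq_single_of_mem m hm fun m' hm' hne => by rw [h0 m' hm' hne]; rfl]
    exact Nat.div_self (Nat.factorial_pos _)
  have hmem : ∀ m, m ∈ h.marksAt v ↔ h.markVertex m = v := by intro m; simp [marksAt]
  by_cases hi : ∃ i : Fin r, h.markVertex (Sum.inr i) = v
  · obtain ⟨i, hi⟩ := hi
    refine key (Sum.inr i) ((hmem _).2 hi) ?_
    rintro (j | i') hm' hne
    · rfl
    · rw [hmem] at hm'
      exact absurd (congrArg Sum.inr (hinj (hm'.trans hi.symm))) hne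
  · have h0 : ∀ m ∈ h.marksAt v, psiExponent k m = 0 := by
      rintro (j | i) hm
      · rfl
      · exact absurd ⟨i, (hmem _).1 hm⟩ hi
    rcases (h.marksAt v).eq_empty_or_nonempty with hv | ⟨m, hm⟩
    · rw [hv]; simp
    · exact key m hm fun m' hm' _ => h0 m' hm'

end ParamCurve

end TropicalCount
end

open TropicalCount in
theorem mainTheorem10 (d n r : ℕ) (k : Fin r → ℕ) (hdim : n + ∑ i, k i + 1 = 3 * d) :
    ∃ B : Finset (AffineSubspace ℝ (Mark n r → ℝ × ℝ)), (∀ H ∈ B, H ≠ ⊤) ∧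
      ∀ ξ : Mark n r → ℝ × ℝ, (∀ H ∈ B, ξ ∉ H) →
      ∀ (V : Type) [Fintype V] (h : ParamCurve n r d V), h.IsSolution k ξ →
        Function.Injective (fun i : Fin r => h.markVertex (Sum.inr i)) →
        h.InOpenTopCone k ∧
        (∀ i, ∃! s, h.pos (h.markVertex (Sum.inr i)) ∈ openRay (ξ (Sum.inr i)) s) ∧
        (∃! o, h.IsAdmissibleOrientation o) ∧
        ∀ (s : Fin r → Fin 3) (o : h.BoundedComponent ⊕ Fin r → h.BoundedComponent ⊕ Fin r → Prop)
          (e : Fin r → h.graph.Dart) (a b : ∀ v : V, h.Flag v),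
          (∀ i, h.pos (h.markVertex (Sum.inr i)) ∈ openRay (ξ (Sum.inr i)) (s i)) →
          h.IsAdmissibleOrientation o →
          (∀ i, (e i).fst = h.markVertex (Sum.inr i) ∧
            ∃ c : h.BoundedComponent, o (Sum.inl c) (Sum.inr i) ∧
              h.component (Sum.inl (h.dartEdge (e i))) = c.1) →
          (∀ v, a v ≠ b v) →
          h.multiplicity k ξ =
            (∏ i, (det (dir (s i)) (h.slope (e i))).natAbs) *
              ∏ v ∈ h.unmarked,
                (det (h.flagSlope h.slope v (a v)) (h.flagSlope h.slope v (b v))).natAbs := by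
  refine ⟨exceptional n r d, fun H hH => ((exceptional_finite n r d).mem_toFinset.1 hH).1, ?_⟩
  intro ξ hξ V _ h hsol hinj
  obtain ⟨ρ⟩ := h.isTree.connected.nonempty
  obtain ⟨hV, s₀, hs₀, hli⟩ := h.exists_linearIndependent_tangent hdim hξ hsol ρ
  have htop := h.inOpenTopCone_of_card_vertices hdim hsol.psi hV
  obtain ⟨F⟩ := h.exists_flow hV hli
  refine ⟨htop, fun i => ⟨s₀ i, hs₀ i, fun s hs => openRay_unique hs (hs₀ i)⟩,
    ⟨F.orientation hinj htop, F.isAdmissibleOrientation_orientation hinj htop,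
      fun o ho => F.orientation_unique hinj htop ho⟩, ?_⟩
  intro s o e a b hs ho he hab
  have hss : s = s₀ := funext fun i => openRay_unique (hs i) (hs₀ i)
  subst hss
  rw [ParamCurve.multiplicity, ParamCurve.prod_multinomial hinj, one_mul, F.index_eq_prod hli hs,
    F.prod_natAbs_det htop hinj s a b hab]
  congr 1
  refine Finset.prod_congr rfl fun i _ => ?_
  obtain ⟨hfst, c, hc, hec⟩ := he i
  rw [← F.dartEdge_eq_inEdge hinj htop ho hfst hc hec]
  rcases F.eq_dart_or_eq_symm (e i) with h' | h'
  · rw [← h']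
  · rw [← ParamCurve.Flow.natAbs_det_neg_right, ← ParamCurve.slope_symm, ← h']
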